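/- **Problem.** An instance of *Server Cloud Scheduling* consists of a finite directed acyclic graph $G=(J,E)$ with exactly one source $S$ and exactly one sink $T$, processing times $p_s(j)\in\mathbb N_0$ on the server and $p_c(j)$ in the cloud for every job $j\in J$, where $p_s(S)=p_s(T)=0$, $p_c(S)=p_c(T)=\infty$ and $p_c(j)\in\mathbb N_0$ for every other job, and a communication delay $c(i,j)\in\mathbb N_0$ for every edge $(i,j)\in E$. A *schedule* $\pi=(J_s,J_c,C)$ consists of a partition $J=J_s\,\dot\cup\,J_c$ (jobs on the server, jobs in the cloud) and completion times $C:J\to\mathbb N_0$. Let $p_\pi(j)=p_s(j)$ if $j\in J_s$ and $p_\pi(j)=p_c(j)$ if $j\in J_c$. The schedule is *valid* if * for all distinct $i,j\in J_s$: $C(i)\le C(j)-p_\pi(j)$ or $C(j)\le C(i)-p_\pi(i)$; * for every edge $(i,j)\in E$ with $i,j$ both in $J_s$ or both in $J_c$: $C(i)\le C(j)-p_\pi(j)$; * for every other edge $(i,j)\in E$: $C(i)+c(i,j)\le C(j)-p_\pi(j)$. Its *makespan* is $C(T)$ and its *cost* is $\sum_{j\in J_c}p_\pi(j)$. Given a budget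 $b\in\mathbb N_0$, let $\mathrm{OPT}$ be the smallest makespan of a valid schedule of cost at most $b$ (such schedules exist: place every job on the server). The *maximum cardinality source and sink dividing cut* of $G$ is $$\varphi(G)=\max_{A}\bigl|\{(j,k)\in E: j\in A,\ k\in J\setminus A\}\bigr| ,$$ where $A$ ranges over the sets of jobs that contain $S$ and for which no edge leads from $J\setminus A$ to $A$. **Theorem.** On task graphs with constant $\varphi$, makespan minimization under a cost budget has an FPTAS. Precisely: there is an algorithm that, given an instance, a budget $b\in\mathbb N_0$ and a rational $\varepsilon>0$ (all numbers in binary), outputs a valid schedule with cost at most $b$ and makespan at most $(1+\varepsilon)\,\mathrm{OPT}$, and such that for every constant $k$ its running time on all inputs with $\varphi(G)\le k$ is bounded by a polynomial, depending only on $k$, in the length of the input and $1/\varepsilon$. -/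

import Mathlib

namespace ServerCloud

/-! ## The scheduling problem -/

/-- An instance of Server Cloud Scheduling with job set `Fin n`: a directed acyclic task graph `E`
with exactly one source and exactly one sink, processing times `pS` (server) and `pC` (cloud), and
a communication delay `delay i j` for every edge `(i, j)` (values off `E` are irrelevant).
Source and sink take no time on the server and infinite time in the cloud. -/
structure Instance where
  n : ℕ
  E : Finset (Fin n × Fin n)
  source : Fin n
  sink : Fin n
  pS : Fin n → ℕ
  pC : Fin n → ℕ∞
  delay : Fin n → Fin n → ℕ
  acyclic : ∀ j, ¬ Relation.TransGen (fun a b => (a, b) ∈ E) j j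
  isSource_iff : ∀ j, (∀ i, (i, j) ∉ E) ↔ j = source
  isSink_iff : ∀ j, (∀ k, (j, k) ∉ E) ↔ j = sink
  pS_source : pS source = 0
  pS_sink : pS sink = 0
  pC_eq_top_iff : ∀ j, pC j = ⊤ ↔ j = source ∨ j = sink

/-- A schedule: the set of jobs placed on the server (all others are in the cloud) and the
completion times. -/
structure Schedule (I : Instance) where
  server : Finset (Fin I.n)
  C : Fin I.n → ℕ

namespace Schedule

variable {I : Instance}

/-- The jobs placed in the cloud. -/
def cloud (π : Schedule I) : Finset (Fin I.n) := π.serverᶜ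

/-- The actual processing time of a job. -/
def time (π : Schedule I) (j : Fin I.n) : ℕ∞ :=
  if j ∈ π.server then (I.pS j : ℕ∞) else I.pC j

/-- `i` and `j` are placed in different contexts, so that the delay of an edge between them has to
be respected. -/
def Crosses (π : Schedule I) (i j : Fin I.n) : Prop :=
  (i ∈ π.server ∧ j ∈ π.cloud) ∨ (i ∈ π.cloud ∧ j ∈ π.server)

/-- Validity: the server works on at most one job at a time, and no job starts before its
predecessors are completed and the required communication is done. A condition
`s ≤ C j - p` of the usual formulation is written `s + p ≤ C j`. -/
structure Valid (π : Schedule I) : Prop where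
  server_sequential : ∀ i ∈ π.server, ∀ j ∈ π.server, i ≠ j →
    (π.C i : ℕ∞) + π.time j ≤ π.C j ∨ (π.C j : ℕ∞) + π.time i ≤ π.C i
  precedence : ∀ i j, (i, j) ∈ I.E → ¬ π.Crosses i j →
    (π.C i : ℕ∞) + π.time j ≤ π.C j
  communication : ∀ i j, (i, j) ∈ I.E → π.Crosses i j →
    (π.C i : ℕ∞) + I.delay i j + π.time j ≤ π.C j

/-- The makespan is the completion time of the sink. -/
def makespan (π : Schedule I) : ℕ := π.C I.sink

/-- The cost is the total time spent on jobs in the cloud. -/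
def cost (π : Schedule I) : ℕ∞ := ∑ j ∈ π.cloud, π.time j

end Schedule

namespace Instance

/-- The sets of jobs that contain the source and have no incoming edge. -/
def initialSets (I : Instance) : Finset (Finset (Fin I.n)) :=
  Finset.univ.filter fun A => I.source ∈ A ∧ ∀ e ∈ I.E, ¬ (e.1 ∉ A ∧ e.2 ∈ A)

/-- The edges that lead from `A` to its complement. -/
def cut (I : Instance) (A : Finset (Fin I.n)) : Finset (Fin I.n × Fin I.n) :=
  I.E.filter fun e => e.1 ∈ A ∧ e.2 ∉ A

/-- The maximum cardinality source and sink dividing cut of the task graph. -/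
def maxCut (I : Instance) : ℕ := I.initialSets.sup fun A => (I.cut A).card

end Instance

/-! ## The machine model

Programs of a small first-order language over finite data (numbers and pairs). Every operation is
charged the full length, in bits, of the value it is applied to (a logarithmic cost measure), so
the measure is polynomially related to Turing machine time. -/

/-- Finite data: natural numbers and ordered pairs. -/
inductive Data where
  | num (k : ℕ)
  | pair (a b : Data)

namespace Data

/-- The length of a value, with numbers written in binary. -/
def size : Data → ℕ
  | num k => Nat.size k + 1
  | pair a b => a.size + b.size + 1

/-- Lists are stored as nested pairs that end in `0`. -/
def ofList : List Data → Data
  | [] => num 0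
  | a :: l => pair a (ofList l)

end Data

/-- The basic operations. -/
inductive Op where
  | ident
  | lit (k : ℕ)
  | fst
  | snd
  | isPair
  | add
  | sub
  | mul
  | div

/-- The value of a basic operation; operations applied to arguments of the wrong form return `0`.
Subtraction is truncated, division rounds down and division by `0` gives `0`. -/
def Op.eval : Op → Data → Data
  | ident, x => x
  | lit k, _ => .num k
  | fst, .pair a _ => a
  | snd, .pair _ b => b
  | isPair, .pair _ _ => .num 1
  | add, .pair (.num a) (.num b) => .num (a + b)
  | sub, .pair (.num a) (.num b) => .num (a - b)
  | mul, .pair (.num a) (.num b) => .num (a * b)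
  | div, .pair (.num a) (.num b) => .num (a / b)
  | _, _ => .num 0

/-- Programs: basic operations, pairing, composition (`comp g f` is `g` after `f`), branching
(`cond t f g` is `f` if `t` returns a value other than `0`, and `g` otherwise) and while-loops
(`loop t f` applies `f` as long as `t` returns a value other than `0`). -/
inductive Prog where
  | op (o : Op)
  | pair (f g : Prog)
  | comp (g f : Prog)
  | cond (t f g : Prog)
  | loop (t f : Prog)

/-- `Runs p x y s`: the program `p` halts on input `x` with output `y` after time exactly `s`. -/
inductive Runs : Prog → Data → Data → ℕ → Prop where
  | op (o : Op) (x : Data) : Runs (.op o) x (o.eval x) x.size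
  | pair {f g : Prog} {x y z : Data} {s t : ℕ} :
      Runs f x y s → Runs g x z t → Runs (.pair f g) x (.pair y z) (s + t + x.size)
  | comp {f g : Prog} {x y z : Data} {s t : ℕ} :
      Runs f x y s → Runs g y z t → Runs (.comp g f) x z (s + t + x.size)
  | cond_true {c f g : Prog} {x v y : Data} {s t : ℕ} :
      Runs c x v s → v ≠ .num 0 → Runs f x y t → Runs (.cond c f g) x y (s + t + x.size)
  | cond_false {c f g : Prog} {x y : Data} {s t : ℕ} :
      Runs c x (.num 0) s → Runs g x y t → Runs (.cond c f g) x y (s + t + x.size)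
  | loop_stop {c f : Prog} {x : Data} {s : ℕ} :
      Runs c x (.num 0) s → Runs (.loop c f) x x (s + x.size)
  | loop_step {c f : Prog} {x v y z : Data} {s t u : ℕ} :
      Runs c x v s → v ≠ .num 0 → Runs f x y t → Runs (.loop c f) y z u →
        Runs (.loop c f) x z (s + t + u + x.size)

/-- Programs are deterministic: output and running time are determined by the input. -/
theorem Runs.deterministic {p : Prog} {x y z : Data} {s t : ℕ}
    (h₁ : Runs p x y s) (h₂ : Runs p x z t) : y = z ∧ s = t := by
  induction h₁ generalizing z t with
  | op => cases h₂; exact ⟨rfl, rfl⟩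
  | pair _ _ ih₁ ih₂ =>
    cases h₂ with
    | pair a b =>
      obtain ⟨rfl, rfl⟩ := ih₁ a
      obtain ⟨rfl, rfl⟩ := ih₂ b
      exact ⟨rfl, rfl⟩
  | comp _ _ ih₁ ih₂ =>
    cases h₂ with
    | comp a b =>
      obtain ⟨rfl, rfl⟩ := ih₁ a
      obtain ⟨rfl, rfl⟩ := ih₂ b
      exact ⟨rfl, rfl⟩
  | cond_true _ hv _ ih₁ ih₂ =>
    cases h₂ with
    | cond_true a _ b =>
      obtain ⟨rfl, rfl⟩ := ih₁ a
      obtain ⟨rfl, rfl⟩ := ih₂ b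
      exact ⟨rfl, rfl⟩
    | cond_false a _ => exact absurd (ih₁ a).1 hv
  | cond_false _ _ ih₁ ih₂ =>
    cases h₂ with
    | cond_true a hv _ => exact absurd (ih₁ a).1.symm hv
    | cond_false a b =>
      obtain ⟨-, rfl⟩ := ih₁ a
      obtain ⟨rfl, rfl⟩ := ih₂ b
      exact ⟨rfl, rfl⟩
  | loop_stop _ ih₁ =>
    cases h₂ with
    | loop_stop a =>
      obtain ⟨-, rfl⟩ := ih₁ a
      exact ⟨rfl, rfl⟩
    | loop_step a hv _ _ => exact absurd (ih₁ a).1.symm hv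
  | loop_step _ hv _ _ ih₁ ih₂ ih₃ =>
    cases h₂ with
    | loop_stop a => exact absurd (ih₁ a).1 hv
    | loop_step a _ b d =>
      obtain ⟨-, rfl⟩ := ih₁ a
      obtain ⟨rfl, rfl⟩ := ih₂ b
      obtain ⟨rfl, rfl⟩ := ih₃ d
      exact ⟨rfl, rfl⟩

/-! ## Encoding of inputs and outputs, numbers in binary -/

/-- The list of the triples `(i, (j, delay i j))` over all edges, in lexicographic order. -/
def Instance.encodeEdges (I : Instance) : Data :=
  .ofList ((((List.finRange I.n).product (List.finRange I.n)).filter (· ∈ I.E)).map fun e =>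
    .pair (.num e.1) (.pair (.num e.2) (.num (I.delay e.1 e.2))))

/-- The list of the pairs `(pS j, pC j)` over all jobs. For source and sink, whose cloud processing
time is always infinite, the second entry is `0`. -/
def Instance.encodeJobs (I : Instance) : Data :=
  .ofList ((List.finRange I.n).map fun j => .pair (.num (I.pS j)) (.num (I.pC j).toNat))

/-- The encoding of an instance: number of jobs, source, sink, processing times, edges with
delays. -/
def Instance.encode (I : Instance) : Data :=
  .ofList [.num I.n, .num I.source, .num I.sink, I.encodeJobs, I.encodeEdges]

/-- The input of the approximation scheme: the instance, the budget, and the accuracy as a reduced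
fraction. -/
def encodeInput (I : Instance) (b : ℕ) (ε : ℚ) : Data :=
  .ofList [I.encode, .num b, .num ε.num.toNat, .num ε.den]

/-- The list of the pairs (location, completion time) over all jobs; the location is `0` for the
server and `1` for the cloud. -/
def Schedule.encode {I : Instance} (π : Schedule I) : Data :=
  .ofList ((List.finRange I.n).map fun j =>
    .pair (.num (if j ∈ π.server then 0 else 1)) (.num (π.C j)))

/-- `π` respects the budget `b` and its makespan is within the factor `1 + ε` of the smallest
makespan of a valid schedule that respects `b`. -/
structure Schedule.IsApprox {I : Instance} (π : Schedule I) (b : ℕ) (ε : ℚ) : Prop where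
  valid : π.Valid
  cost_le : π.cost ≤ b
  makespan_le : ∀ π' : Schedule I, π'.Valid → π'.cost ≤ b →
    (π.makespan : ℚ) ≤ (1 + ε) * π'.makespan

end ServerCloud

namespace ServerCloud

/-! ## Polynomial time functions between encoded types -/

/-! The algorithm is a dynamic program over partial schedules, built by appending one job at a time
at its earliest possible start. To judge how a partial schedule can continue, it suffices to know
which jobs are done, from when on the server is idle, and the location and completion time of each
done job that still has an undone successor. This information is `key`; among partial schedules with
equal keys `prune` keeps a cheapest one.

Approximation. Every completion time is rounded up by a factor of at most `1 + 1/M`, where `M =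
n(⌊1/ε⌋ + 2)`. Fix any schedule within the budget and order the jobs by start plus completion time,
ties broken by a topological rank. Following this order with the same locations, the invariant
`Tracks` says that after `m` appended jobs some kept partial schedule has remembered times at most
`(1 + 1/M)^m` times those of the fixed schedule and costs no more than it does on the done jobs.
`Tracks.step` extends the invariant by one job, and `Tracks.congr` shows that it survives pruning,
since apart from the cost it depends on the key only. At most `n - 1` roundings accumulate, and `(1
+ 1/M)^n ≤ 1 + ε` (`one_add_pow_le`). The sink is on the server, so its completion time is at most
the idle time of the server, which is what the final choice minimizes (`solution_le`).

Running time. The done jobs form an initial set, so at most `φ(G)` edges leave them. These edges,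
labelled with the codes of their tails, together with the idle time of the server determine the key
(`key_eq_of_labelledCut_eq`). Rounded times have the form `a * 2 ^ i` with `a ≤ 2M` and `i` linear
in the input length, so there are polynomially many, say `g`, and a layer has at most `g (2g|E| +
1)^k` members (`length_layer_le`). The parameter `k` occurs only in this count and not in the
program.

That one round takes polynomial time follows from closure properties of `PolyTime`, applied by
`fun_prop`. The outer loop is not polynomial for unbounded `k`, so it is assembled by hand in
`exists_program`. -/

theorem eval_mono (q : Polynomial ℕ) {a b : ℕ} (h : a ≤ b) : q.eval a ≤ q.eval b := by
  rw [Polynomial.eval_eq_sum, Polynomial.eval_eq_sum]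
  exact Finset.sum_le_sum fun i _ => Nat.mul_le_mul_left _ (Nat.pow_le_pow_left h i)

/-- A type whose elements are represented by finite data. -/
class Coded (α : Type) where
  /-- The representation. -/
  enc : α → Data

open Coded (enc)

/-- A nonempty list has the same representation as the pair of its head and tail, and a Boolean the
same as `0` or `1`. Hence `cons` and `Bool.toNat` are computed by the identity operation. -/
instance : Coded ℕ := ⟨.num⟩
instance : Coded Bool := ⟨fun b => .num b.toNat⟩
instance {α β : Type} [Coded α] [Coded β] : Coded (α × β) := ⟨fun x => .pair (enc x.1) (enc x.2)⟩
instance {α : Type} [Coded α] : Coded (List α) := ⟨fun l => .ofList (l.map enc)⟩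

/-- The length of the representation. -/
def len {α : Type} [Coded α] (a : α) : ℕ := (enc a).size

section Combinators

variable {α β γ δ : Type} [Coded α] [Coded β] [Coded γ] [Coded δ]

theorem Data.size_pos (d : Data) : 1 ≤ d.size := by cases d <;> simp [Data.size]

@[simp] theorem len_prod (a : α × β) : len a = len a.1 + len a.2 + 1 := rfl
@[simp] theorem len_nat (a : ℕ) : len a = Nat.size a + 1 := rfl
@[simp] theorem len_nil : len ([] : List α) = 1 := rfl
@[simp] theorem len_cons (a : α) (l : List α) : len (a :: l) = len a + len l + 1 := rfl

theorem len_bool (b : Bool) : len b ≤ 2 := by cases b <;> decide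

theorem len_append (l₁ l₂ : List α) : len (l₁ ++ l₂) ≤ len l₁ + len l₂ := by
  induction l₁ with
  | nil => simp
  | cons a l ih => simp only [List.cons_append, len_cons]; omega

theorem length_le_len (l : List α) : l.length ≤ len l := by
  induction l with
  | nil => simp
  | cons a l ih => simp only [List.length_cons, len_cons]; omega

theorem len_le_of_mem {a : α} {l : List α} (h : a ∈ l) : len a ≤ len l := by
  induction l with
  | nil => simp at h
  | cons b l ih =>
    simp only [len_cons]
    rcases List.mem_cons.1 h with rfl | h
    · omega
    · have := ih h; omega

theorem len_list_le {l : List α} {m : ℕ} (h : ∀ a ∈ l, len a ≤ m) :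
    len l ≤ l.length * (m + 1) + 1 := by
  induction l with
  | nil => simp
  | cons b l ih =>
    have h1 := ih fun a ha => h a (by simp [ha])
    have h2 := h b (by simp)
    simp only [List.length_cons, len_cons, Nat.add_mul]
    omega

/-- The function is computed by a program in polynomial time. -/
@[fun_prop]
def PolyTime (f : α → β) : Prop :=
  ∃ (p : Prog) (q : Polynomial ℕ), ∀ a, ∃ t, Runs p (enc a) (enc (f a)) t ∧
    t ≤ q.eval (len a) ∧ len (f a) ≤ q.eval (len a)

/-- Each round pays for the test, the body and the size of the current value, each at most `T`; the
final failing test accounts for the extra round. -/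
theorem Runs.loop_of_seq {c f : Prog} {T : ℕ} {m : ℕ} {x : ℕ → Data}
    (hc : ∀ i < m, ∃ v t, Runs c (x i) v t ∧ v ≠ .num 0 ∧ t ≤ T)
    (hf : ∀ i < m, ∃ t, Runs f (x i) (x (i + 1)) t ∧ t ≤ T)
    (hs : ∃ t, Runs c (x m) (.num 0) t ∧ t ≤ T)
    (hx : ∀ i ≤ m, (x i).size ≤ T) :
    ∃ t, Runs (.loop c f) (x 0) (x m) t ∧ t ≤ (m + 1) * (3 * T) := by
  induction m generalizing x with
  | zero =>
    obtain ⟨t, ht, htT⟩ := hs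
    have := hx 0 le_rfl
    exact ⟨_, Runs.loop_stop ht, by omega⟩
  | succ m ih =>
    obtain ⟨v, s, hs1, hv, hsT⟩ := hc 0 (by omega)
    obtain ⟨t, ht, htT⟩ := hf 0 (by omega)
    have h0 := hx 0 (by omega)
    obtain ⟨u, hu, huT⟩ := ih (x := fun i => x (i + 1)) (fun i hi => hc (i + 1) (by omega))
      (fun i hi => hf (i + 1) (by omega)) hs (fun i hi => hx (i + 1) (by omega))
    refine ⟨_, .loop_step hs1 hv ht hu, ?_⟩
    have : (m + 1 + 1) * (3 * T) = (m + 1) * (3 * T) + 3 * T := by ring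
    omega

theorem size_add_le (a b : ℕ) : Nat.size (a + b) ≤ Nat.size a + Nat.size b := by
  rw [Nat.size_le, pow_add]
  have ha := Nat.lt_size_self a
  have hb := Nat.lt_size_self b
  rcases Nat.eq_zero_or_pos a with rfl | ha0
  · simpa using hb
  rcases Nat.eq_zero_or_pos b with rfl | hb0
  · simpa using ha
  nlinarith

theorem size_mul_le (a b : ℕ) : Nat.size (a * b) ≤ Nat.size a + Nat.size b := by
  rw [Nat.size_le, pow_add]
  exact Nat.mul_lt_mul'' (Nat.lt_size_self a) (Nat.lt_size_self b)

theorem size_eval_le (o : Op) : ∃ k, ∀ x : Data, (o.eval x).size ≤ 2 * x.size + k := by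
  have h0 : Nat.size 0 = 0 := Nat.size_zero
  have h1 : Nat.size 1 = 1 := Nat.size_one
  refine ⟨(match o with | .lit k => Nat.size k | _ => 0) + 1, fun x => ?_⟩
  have hx := x.size_pos
  cases o with
  | ident => simp only [Op.eval]; omega
  | lit k => simp only [Op.eval, Data.size]; omega
  | fst => cases x <;> simp only [Op.eval, Data.size] <;> omega
  | snd => cases x <;> simp only [Op.eval, Data.size] <;> omega
  | isPair => cases x <;> simp only [Op.eval, Data.size] <;> omega
  | add =>
    rcases x with _ | ⟨_ | _, _ | _⟩ <;> simp only [Op.eval, Data.size] <;> try omega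
    rename_i a b
    have := size_add_le a b
    omega
  | sub =>
    rcases x with _ | ⟨_ | _, _ | _⟩ <;> simp only [Op.eval, Data.size] <;> try omega
    rename_i a b
    have := Nat.size_le_size (Nat.sub_le a b)
    omega
  | mul =>
    rcases x with _ | ⟨_ | _, _ | _⟩ <;> simp only [Op.eval, Data.size] <;> try omega
    rename_i a b
    have := size_mul_le a b
    omega
  | div =>
    rcases x with _ | ⟨_ | _, _ | _⟩ <;> simp only [Op.eval, Data.size] <;> try omega
    rename_i a b
    have := Nat.size_le_size (Nat.div_le_self a b)
    omega

/-! ### Closure properties: composition, branching, arithmetic and Boolean tests -/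

namespace PolyTime

theorem of_op (o : Op) {f : α → β} (h : ∀ a, o.eval (enc a) = enc (f a)) : PolyTime f := by
  obtain ⟨k, hk⟩ := size_eval_le o
  refine ⟨.op o, 2 * Polynomial.X + Polynomial.C k, fun a =>
    ⟨(enc a).size, h a ▸ Runs.op o (enc a), ?_, ?_⟩⟩
  · simp [len]; omega
  · have := hk (enc a)
    rw [h] at this
    simpa [len] using this

@[fun_prop] theorem id : PolyTime (fun a : α => a) := of_op .ident fun _ => rfl

/-- The second program runs on `f a`, so its time is controlled through the bound on the output
length that is part of `PolyTime`. -/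
theorem comp {g : β → γ} {f : α → β} (hg : PolyTime g) (hf : PolyTime f) :
    PolyTime (fun a => g (f a)) := by
  obtain ⟨p, q, h⟩ := hf
  obtain ⟨p', q', h'⟩ := hg
  refine ⟨.comp p' p, q + q'.comp q + Polynomial.X, fun a => ?_⟩
  obtain ⟨s, hs, hsq, hlen⟩ := h a
  obtain ⟨t, ht, htq, hlen'⟩ := h' (f a)
  have := eval_mono q' hlen
  refine ⟨_, .comp hs ht, ?_, ?_⟩ <;> simp only [Polynomial.eval_add, Polynomial.eval_comp,
    Polynomial.eval_X] <;> simp only [len] at * <;> omega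

attribute [fun_prop] comp

@[fun_prop]
theorem prodMk {f : α → β} {g : α → γ} (hf : PolyTime f) (hg : PolyTime g) :
    PolyTime (fun a => (f a, g a)) := by
  obtain ⟨p, q, h⟩ := hf
  obtain ⟨p', q', h'⟩ := hg
  refine ⟨.pair p p', q + q' + Polynomial.X + 1, fun a => ?_⟩
  obtain ⟨s, hs, hsq, hlen⟩ := h a
  obtain ⟨t, ht, htq, hlen'⟩ := h' a
  refine ⟨_, .pair hs ht, ?_, ?_⟩ <;> simp only [Polynomial.eval_add,
    Polynomial.eval_X, Polynomial.eval_one, len_prod] <;> simp only [len] at * <;> omega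

@[fun_prop]
theorem fst {f : α → β × γ} (hf : PolyTime f) : PolyTime (fun a => (f a).1) :=
  (of_op (f := Prod.fst) .fst fun _ => rfl).comp hf

@[fun_prop]
theorem snd {f : α → β × γ} (hf : PolyTime f) : PolyTime (fun a => (f a).2) :=
  (of_op (f := Prod.snd) .snd fun _ => rfl).comp hf

@[fun_prop]
theorem const (b : β) : PolyTime (fun _ : α => b) := by
  have key : ∀ d : Data, ∃ (p : Prog) (q : Polynomial ℕ), ∀ x : Data, ∃ t, Runs p x d t ∧
      t ≤ q.eval x.size := by
    intro d
    induction d with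
    | num k => exact ⟨.op (.lit k), .X, fun x => ⟨_, .op (.lit k) x, by simp⟩⟩
    | pair a b iha ihb =>
      obtain ⟨p, q, h⟩ := iha
      obtain ⟨p', q', h'⟩ := ihb
      refine ⟨.pair p p', q + q' + .X, fun x => ?_⟩
      obtain ⟨s, hs, hsq⟩ := h x
      obtain ⟨t, ht, htq⟩ := h' x
      exact ⟨_, .pair hs ht, by simp; omega⟩
  obtain ⟨p, q, h⟩ := key (enc b)
  refine ⟨p, q + .C (len b), fun a => ?_⟩
  obtain ⟨t, ht, htq⟩ := h (enc a)
  refine ⟨t, ht, ?_, by simp⟩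
  simp only [Polynomial.eval_add, len] at *
  omega

theorem nat_ite {c : α → ℕ} {f g : α → β} (hc : PolyTime c) (hf : PolyTime f)
    (hg : PolyTime g) : PolyTime (fun a => if c a = 0 then g a else f a) := by
  obtain ⟨p₀, q₀, h₀⟩ := hc
  obtain ⟨p, q, h⟩ := hf
  obtain ⟨p', q', h'⟩ := hg
  refine ⟨.cond p₀ p p', q₀ + q + q' + .X, fun a => ?_⟩
  obtain ⟨s, hs, hsq, -⟩ := h₀ a
  obtain ⟨t, ht, htq, hlen⟩ := h a
  obtain ⟨u, hu, huq, hlen'⟩ := h' a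
  simp only [Polynomial.eval_add, Polynomial.eval_X]
  by_cases hca : c a = 0
  · rw [hca] at hs
    exact ⟨_, by simpa only [hca] using .cond_false hs hu, by simp only [len] at *; omega,
      by simp only [hca, if_true]; omega⟩
  · exact ⟨_, by simpa only [hca] using .cond_true hs (by simpa [enc] using hca) ht,
      by simp only [len] at *; omega, by simp only [hca, if_false]; omega⟩

theorem bool_cond {c : α → Bool} {f g : α → β} (hc : PolyTime c) (hf : PolyTime f)
    (hg : PolyTime g) : PolyTime (fun a => bif c a then f a else g a) := by
  convert ((of_op (f := Bool.toNat) .ident fun _ => rfl).comp hc).nat_ite hf hg using 2 with a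
  cases c a <;> simp

@[fun_prop]
theorem ite {P : α → Prop} [DecidablePred P] {f g : α → β} (hc : PolyTime fun a => decide (P a))
    (hf : PolyTime f) (hg : PolyTime g) : PolyTime (fun a => if P a then f a else g a) := by
  simpa only [Bool.cond_decide] using hc.bool_cond hf hg

@[fun_prop]
theorem nat_add {f g : α → ℕ} (hf : PolyTime f) (hg : PolyTime g) :
    PolyTime (fun a => f a + g a) :=
  (of_op (f := fun x : ℕ × ℕ => x.1 + x.2) .add fun _ => rfl).comp (hf.prodMk hg)

@[fun_prop]
theorem nat_sub {f g : α → ℕ} (hf : PolyTime f) (hg : PolyTime g) :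
    PolyTime (fun a => f a - g a) :=
  (of_op (f := fun x : ℕ × ℕ => x.1 - x.2) .sub fun _ => rfl).comp (hf.prodMk hg)

@[fun_prop]
theorem nat_mul {f g : α → ℕ} (hf : PolyTime f) (hg : PolyTime g) :
    PolyTime (fun a => f a * g a) :=
  (of_op (f := fun x : ℕ × ℕ => x.1 * x.2) .mul fun _ => rfl).comp (hf.prodMk hg)

@[fun_prop]
theorem nat_div {f g : α → ℕ} (hf : PolyTime f) (hg : PolyTime g) :
    PolyTime (fun a => f a / g a) :=
  (of_op (f := fun x : ℕ × ℕ => x.1 / x.2) .div fun _ => rfl).comp (hf.prodMk hg)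

@[fun_prop]
theorem decide_le {f g : α → ℕ} (hf : PolyTime f) (hg : PolyTime g) :
    PolyTime (fun a => decide (f a ≤ g a)) := by
  convert (hf.nat_sub hg).nat_ite (const false) (const true) using 2 with a
  split_ifs with h <;> simp only [decide_eq_true_eq, decide_eq_false_iff_not] <;> omega

@[fun_prop]
theorem decide_eq {f g : α → ℕ} (hf : PolyTime f) (hg : PolyTime g) :
    PolyTime (fun a => decide (f a = g a)) := by
  convert ((hf.nat_sub hg).nat_add (hg.nat_sub hf)).nat_ite (const false) (const true) using 2
    with a
  split_ifs with h <;> simp only [decide_eq_true_eq, decide_eq_false_iff_not] <;> omega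

@[fun_prop]
theorem max {f g : α → ℕ} (hf : PolyTime f) (hg : PolyTime g) :
    PolyTime (fun a => Max.max (f a) (g a)) := by
  simp only [max_def]
  fun_prop

@[fun_prop]
theorem decide_not {P : α → Prop} [DecidablePred P] (hP : PolyTime fun a => decide (P a)) :
    PolyTime (fun a => decide (¬ P a)) := by
  convert hP.bool_cond (const false) (const true) using 2 with a
  by_cases h : P a <;> simp [h]

@[fun_prop]
theorem decide_and {P Q : α → Prop} [DecidablePred P] [DecidablePred Q]
    (hP : PolyTime fun a => decide (P a)) (hQ : PolyTime fun a => decide (Q a)) :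
    PolyTime (fun a => decide (P a ∧ Q a)) := by
  convert hP.bool_cond hQ (const false) using 2 with a
  by_cases h : P a <;> simp [h]

@[fun_prop]
theorem decide_or {P Q : α → Prop} [DecidablePred P] [DecidablePred Q]
    (hP : PolyTime fun a => decide (P a)) (hQ : PolyTime fun a => decide (Q a)) :
    PolyTime (fun a => decide (P a ∨ Q a)) := by
  convert hP.bool_cond (const true) hQ using 2 with a
  by_cases h : P a <;> simp [h]

@[fun_prop]
theorem decide_imp {P Q : α → Prop} [DecidablePred P] [DecidablePred Q]
    (hP : PolyTime fun a => decide (P a)) (hQ : PolyTime fun a => decide (Q a)) :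
    PolyTime (fun a => decide (P a → Q a)) := by
  convert hP.bool_cond hQ (const true) using 2 with a
  by_cases h : P a <;> simp [h]

end PolyTime
end Combinators
-- Closure properties: iteration and list operations
section Lists

variable {α β γ δ : Type} [Coded α] [Coded β] [Coded γ] [Coded δ]

namespace PolyTime

@[fun_prop]
theorem cons {f : α → β} {g : α → List β} (hf : PolyTime f) (hg : PolyTime g) :
    PolyTime (fun a => f a :: g a) :=
  (of_op (f := fun x : β × List β => x.1 :: x.2) .ident fun _ => rfl).comp (hf.prodMk hg)

@[fun_prop]
theorem tail {f : α → List β} (hf : PolyTime f) : PolyTime (fun a => (f a).tail) :=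
  (of_op (f := fun l : List β => l.tail) .snd fun l => by cases l <;> rfl).comp hf

@[fun_prop]
theorem length_ne_zero {f : α → List β} (hf : PolyTime f) :
    PolyTime (fun a => decide ((f a).length ≠ 0)) :=
  (of_op (f := fun l : List β => decide (l.length ≠ 0)) .isPair
    fun l => by cases l <;> simp [enc, Op.eval, Data.ofList]).comp hf

theorem list_cases {l : α → List β} {f : α → γ} {g : α → β → List β → γ} (hl : PolyTime l)
    (hf : PolyTime f) (hg : PolyTime fun x : α × β × List β => g x.1 x.2.1 x.2.2) :
    PolyTime (fun a => match l a with | [] => f a | b :: l' => g a b l') := by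
  obtain ⟨p₀, q₀, h₀⟩ := hl.prodMk hl.length_ne_zero
  obtain ⟨p₁, q₁, h₁⟩ := PolyTime.id.prodMk hl
  obtain ⟨p, q, h⟩ := hf
  obtain ⟨p', q', h'⟩ := hg
  refine ⟨.cond (.comp (.op .snd) p₀) (.comp p' p₁) p,
    3 * q₀ + q + q₁ + q'.comp q₁ + 3 * .X, fun a => ?_⟩
  obtain ⟨s, hs, hsq, hs'⟩ := h₀ a
  have hc := Runs.comp hs (.op .snd _)
  simp only [Polynomial.eval_add, Polynomial.eval_X, Polynomial.eval_mul, Polynomial.eval_comp,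
    Polynomial.eval_ofNat]
  cases hla : l a with
  | nil =>
    obtain ⟨t, ht, htq, hlen⟩ := h a
    simp only [hla, len] at hc hs' ⊢
    exact ⟨_, .cond_false hc ht, by simp only [len] at *; omega, by simp only [len] at *; omega⟩
  | cons b l' =>
    obtain ⟨t, ht, htq, hlen⟩ := h₁ a
    simp only [hla] at ht hlen
    obtain ⟨u, hu, huq, hlen'⟩ := h' (a, b, l')
    have hm := eval_mono q' (a := len (a, b, l')) hlen
    simp only [hla, len] at hc hs' ⊢
    refine ⟨_, .cond_true hc (by simp [Op.eval, enc]) (.comp ht hu), ?_, ?_⟩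
    · simp only [len] at *; omega
    · simp only [len] at *; omega

/-- The number of rounds is needed for the analysis only; the program just tests `c`. The essential
hypothesis is that all intermediate values stay polynomially long. -/
theorem iterate {c : α → Bool} {f : α → α} (count : α → ℕ) (q : Polynomial ℕ) (hc : PolyTime c)
    (hf : PolyTime f) (hcount : ∀ a, count a ≤ q.eval (len a))
    (hlen : ∀ a, ∀ i ≤ count a, len (f^[i] a) ≤ q.eval (len a))
    (htrue : ∀ a, ∀ i < count a, c (f^[i] a) = true)
    (hfalse : ∀ a, c (f^[count a] a) = false) : PolyTime (fun a => f^[count a] a) := by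
  obtain ⟨p₀, q₀, h₀⟩ := hc
  obtain ⟨p, q₁, h⟩ := hf
  refine ⟨.loop p₀ p, (q + 1) * (3 * (q₀.comp q + q₁.comp q + q)), fun a => ?_⟩
  have B := fun i hi => eval_mono q₀ (hlen a i hi)
  have B' := fun i hi => eval_mono q₁ (hlen a i hi)
  obtain ⟨t, ht, htq⟩ := Runs.loop_of_seq (c := p₀) (f := p) (m := count a)
    (x := fun i => enc (f^[i] a))
    (T := (q₀.comp q + q₁.comp q + q).eval (len a)) (fun i hi => by
      obtain ⟨t, ht, htq, -⟩ := h₀ (f^[i] a)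
      refine ⟨_, t, ht, by simp [htrue a i hi, enc], ?_⟩
      have := B i hi.le
      simp only [Polynomial.eval_add, Polynomial.eval_comp]
      omega) (fun i hi => by
      obtain ⟨t, ht, htq, -⟩ := h (f^[i] a)
      rw [Function.iterate_succ_apply']
      refine ⟨t, ht, ?_⟩
      have := B' i hi.le
      simp only [Polynomial.eval_add, Polynomial.eval_comp]
      omega) (by
      obtain ⟨t, ht, htq, -⟩ := h₀ (f^[count a] a)
      rw [hfalse] at ht
      refine ⟨t, ht, ?_⟩
      have := B _ le_rfl
      simp only [Polynomial.eval_add, Polynomial.eval_comp]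
      omega) (fun i hi => by
      have := hlen a i hi
      simp only [Polynomial.eval_add, Polynomial.eval_comp]
      simp only [len] at *
      omega)
  refine ⟨t, ht, htq.trans ?_, (hlen a _ le_rfl).trans ?_⟩
  · simp only [Polynomial.eval_add, Polynomial.eval_mul, Polynomial.eval_ofNat,
      Polynomial.eval_one]
    have := hcount a
    gcongr
  · simp only [Polynomial.eval_add, Polynomial.eval_mul, Polynomial.eval_ofNat,
      Polynomial.eval_one]
    nlinarith

omit [Coded β] in
theorem len_foldl_le {F : γ → β → γ} {l : List β} {c : γ} {m : ℕ}
    (h : ∀ c, ∀ b ∈ l, len (F c b) ≤ len c + m) : len (l.foldl F c) ≤ len c + l.length * m := by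
  induction l generalizing c with
  | nil => simp
  | cons b l ih =>
    have h1 := ih (c := F c b) fun c b' hb => h c b' (by simp [hb])
    have h2 := h c b (by simp)
    simp only [List.foldl_cons, List.length_cons, Nat.add_mul, one_mul]
    omega

/-- The growth of the accumulator in one step is additive and bounded independently of the
accumulator. This excludes repeated squaring and keeps all intermediate values polynomially long. -/
theorem foldl {l : α → List β} {c : α → γ} {F : α → γ → β → γ} (q : Polynomial ℕ)
    (hq : ∀ a c b, len (F a c b) ≤ len c + q.eval (len a + len b))
    (hl : PolyTime l) (hc : PolyTime c) (hF : PolyTime fun x : α × γ × β => F x.1 x.2.1 x.2.2) :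
    PolyTime (fun a => (l a).foldl (F a) (c a)) := by
  let step : List β × α × γ → List β × α × γ := fun x =>
    match x.1 with
    | [] => x
    | b :: l' => (l', x.2.1, F x.2.1 x.2.2 b)
  have hstep : PolyTime step :=
    list_cases (f := fun x => x) (g := fun x b l' => (l', x.2.1, F x.2.1 x.2.2 b)) (by fun_prop)
      (by fun_prop) (.prodMk (by fun_prop) (.prodMk (by fun_prop)
        (hF.comp (f := fun x : (List β × α × γ) × β × List β => (x.1.2.1, x.1.2.2, x.2.1))
          (by fun_prop))))
  have key : ∀ (i : ℕ) (l : List β) (a : α) (c : γ), i ≤ l.length →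
      step^[i] (l, a, c) = (l.drop i, a, (l.take i).foldl (F a) c) := by
    intro i
    induction i with
    | zero => intro l a c _; rfl
    | succ i ih =>
      intro l a c hi
      cases l with
      | nil => simp at hi
      | cons b l =>
        rw [Function.iterate_succ_apply, ih l a _ (by simpa using hi)]
        rfl
  have main := iterate (c := fun x : List β × α × γ => decide (x.1.length ≠ 0)) (f := step)
    (fun x => x.1.length) (.X + .X * q.comp (2 * .X)) (by fun_prop) hstep ?_ ?_ ?_ ?_
  · convert (main.comp (hl.prodMk (PolyTime.id.prodMk hc))).snd.snd using 2 with a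
    rw [key _ _ _ _ le_rfl]
    simp
  · rintro ⟨l, a, c⟩
    have := length_le_len l
    simp only [len_prod, Polynomial.eval_add, Polynomial.eval_X]
    omega
  · rintro ⟨l, a, c⟩ i hi
    rw [key _ _ _ _ hi]
    have h1 : len (l.drop i) ≤ len l := by
      conv_rhs => rw [← List.take_append_drop i l]
      generalize l.take i = l₁
      induction l₁ with
      | nil => simp
      | cons b l ih => simp only [List.cons_append, len_cons]; omega
    have h2 := len_foldl_le (F := F a) (l := l.take i) (c := c)
      (m := q.eval (2 * len (l, a, c))) (fun c' b hb => (hq a c' b).trans (by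
        have := len_le_of_mem (List.mem_of_mem_take hb)
        gcongr
        exact eval_mono q (by simp only [len_prod]; omega)))
    have h3 : (l.take i).length * q.eval (2 * len (l, a, c)) ≤
        len (l, a, c) * q.eval (2 * len (l, a, c)) := by
      gcongr
      have := length_le_len l
      simp only [len_prod, List.length_take]
      omega
    simp only [Polynomial.eval_add, Polynomial.eval_X, Polynomial.eval_mul, Polynomial.eval_comp,
      Polynomial.eval_ofNat] at h2 h3 ⊢
    simp only [len_prod] at h2 h3 ⊢
    omega
  · rintro ⟨l, a, c⟩ i hi
    rw [key _ _ _ _ hi.le]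
    simp at hi ⊢
    omega
  · rintro ⟨l, a, c⟩
    rw [key _ _ _ _ le_rfl]
    simp

@[fun_prop]
theorem reverse {l : α → List β} (hl : PolyTime l) : PolyTime (fun a => (l a).reverse) := by
  convert foldl (F := fun (_ : α) c b => b :: c) (.X + 1) (fun a c b => by simp; omega) hl
    (const []) (by fun_prop) using 2 with a
  generalize l a = l
  suffices ∀ l₁ : List β, l.foldl (fun c b => b :: c) l₁ = l.reverse ++ l₁ by simp [this]
  induction l with
  | nil => simp
  | cons b l ih => intro l₁; simp [ih]

theorem foldr {l : α → List β} {c : α → γ} {F : α → β → γ → γ} (q : Polynomial ℕ)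
    (hq : ∀ a b c, len (F a b c) ≤ len c + q.eval (len a + len b))
    (hl : PolyTime l) (hc : PolyTime c) (hF : PolyTime fun x : α × β × γ => F x.1 x.2.1 x.2.2) :
    PolyTime (fun a => (l a).foldr (F a) (c a)) := by
  convert foldl (F := fun a c b => F a b c) q (fun a c b => hq a b c) hl.reverse hc
    (hF.comp (f := fun x : α × γ × β => (x.1, x.2.2, x.2.1)) (by fun_prop)) using 2 with a
  simp [List.foldl_reverse]

theorem map {l : α → List β} {F : α → β → γ} (hl : PolyTime l)
    (hF : PolyTime fun x : α × β => F x.1 x.2) : PolyTime (fun a => (l a).map (F a)) := by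
  have hF' : PolyTime fun x : α × β × List γ => F x.1 x.2.1 :: x.2.2 :=
    (hF.comp (f := fun x : α × β × List γ => (x.1, x.2.1)) (by fun_prop)).cons (by fun_prop)
  obtain ⟨p, q, h⟩ := hF
  convert foldr (F := fun a b c => F a b :: c) (q.comp (.X + 1) + 1) (fun a b c => by
    obtain ⟨t, -, -, hlen⟩ := h (a, b)
    simp only [len_cons, len_prod, Polynomial.eval_add, Polynomial.eval_comp, Polynomial.eval_X,
      Polynomial.eval_one] at *
    omega) hl (const []) hF' using 2 with a
  induction l a with
  | nil => rfl
  | cons b l ih => rw [List.foldr_cons, ← ih]; simp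

@[fun_prop]
theorem append {f g : α → List β} (hf : PolyTime f) (hg : PolyTime g) :
    PolyTime (fun a => f a ++ g a) := by
  convert foldr (F := fun (_ : α) b c => b :: c) (.X + 1) (fun a c b => by simp; omega) hf
    hg (by fun_prop) using 2 with a
  induction f a with
  | nil => rfl
  | cons b l ih => rw [List.foldr_cons, ← ih]; simp

theorem flatMap {l : α → List β} {F : α → β → List γ} (hl : PolyTime l)
    (hF : PolyTime fun x : α × β => F x.1 x.2) : PolyTime (fun a => (l a).flatMap (F a)) := by
  have hF' : PolyTime fun x : α × β × List γ => F x.1 x.2.1 ++ x.2.2 :=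
    (hF.comp (f := fun x : α × β × List γ => (x.1, x.2.1)) (by fun_prop)).append (by fun_prop)
  obtain ⟨p, q, h⟩ := hF
  convert foldr (F := fun a b c => F a b ++ c) (q.comp (.X + 1) + 1) (fun a b c => by
    obtain ⟨t, -, -, hlen⟩ := h (a, b)
    have := len_append (F a b) c
    simp only [len_prod, Polynomial.eval_add, Polynomial.eval_comp, Polynomial.eval_X,
      Polynomial.eval_one] at *
    omega) hl (const []) hF' using 2 with a
  induction l a with
  | nil => rfl
  | cons b l ih => rw [List.foldr_cons, ← ih]; simp

theorem filter {l : α → List β} {P : α → β → Bool} (hl : PolyTime l)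
    (hP : PolyTime fun x : α × β => P x.1 x.2) : PolyTime (fun a => (l a).filter (P a)) := by
  convert hl.flatMap (F := fun a b => bif P a b then [b] else [])
    (hP.bool_cond (by fun_prop) (by fun_prop)) using 2 with a
  induction l a with
  | nil => rfl
  | cons b l ih => cases h : P a b <;> simp [h, ih]

theorem decide_exists {l : α → List β} {P : α → β → Prop} [∀ a, DecidablePred (P a)]
    (hl : PolyTime l) (hP : PolyTime fun x : α × β => decide (P x.1 x.2)) :
    PolyTime (fun a => decide (∃ b ∈ l a, P a b)) := by
  convert foldr (F := fun a b c => bif decide (P a b) then true else c) 2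
    (fun a b c => by
      have := len_bool (bif decide (P a b) then true else c)
      simp only [Polynomial.eval_ofNat]
      omega) hl (const false)
    ((hP.comp (f := fun x : α × β × Bool => (x.1, x.2.1)) (by fun_prop)).bool_cond
      (by fun_prop) (by fun_prop)) using 2 with a
  induction l a with
  | nil => simp
  | cons b l ih => rw [List.foldr_cons, ← ih]; by_cases h : P a b <;> simp [h]

theorem decide_forall {l : α → List β} {P : α → β → Prop} [∀ a, DecidablePred (P a)]
    (hl : PolyTime l) (hP : PolyTime fun x : α × β => decide (P x.1 x.2)) :
    PolyTime (fun a => decide (∀ b ∈ l a, P a b)) := by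
  convert (decide_exists (P := fun a b => ¬ P a b) hl hP.decide_not).decide_not using 2 with a
  simp

@[fun_prop]
theorem length {l : α → List β} (hl : PolyTime l) : PolyTime (fun a => (l a).length) := by
  convert foldl (F := fun (_ : α) c (_ : β) => c + 1) 1 (fun a c b => by
    have := Nat.size_le.2 (show c + 1 < 2 ^ (Nat.size c + 1) by
      have := Nat.lt_size_self c
      omega)
    simp only [len_nat, Polynomial.eval_one]
    omega) hl (const 0) (by fun_prop) using 2 with a
  simp

@[fun_prop]
theorem range_length {l : α → List β} (hl : PolyTime l) :
    PolyTime (fun a => List.range (l a).length) := by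
  -- The growth bound of `foldl` has to hold for every accumulator, also one whose counter is huge.
  -- Capping the entry at the list length, carried along as second component, ensures this and
  -- changes nothing in the actual run.
  have main := foldl (α := List β × ℕ) (l := fun x => x.1) (c := fun _ => ((0 : ℕ), ([] : List ℕ)))
    (F := fun x c (_ : β) => (c.1 + 1, (if c.1 ≤ x.2 then c.1 else x.2) :: c.2)) (.X + 2)
    (fun a c b => by
      have h1 := Nat.size_le.2 (show c.1 + 1 < 2 ^ (Nat.size c.1 + 1) by
        have := Nat.lt_size_self c.1
        omega)
      have h2 : Nat.size (if c.1 ≤ a.2 then c.1 else a.2) ≤ Nat.size a.2 := by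
        split_ifs with h
        · exact Nat.size_le_size h
        · exact le_rfl
      simp only [len_nat, len_prod, len_cons, Polynomial.eval_add, Polynomial.eval_X,
        Polynomial.eval_ofNat]
      omega) (by fun_prop) (by fun_prop) (by fun_prop)
  convert (main.comp (hl.prodMk hl.length)).snd.reverse using 2 with a
  generalize l a = l
  have key : ∀ (N : ℕ) (l₁ : List β) (k : ℕ) (acc : List ℕ), k + l₁.length ≤ N →
      (l₁.foldl (fun c _ => (c.1 + 1, (if c.1 ≤ N then c.1 else N) :: c.2)) (k, acc)).2 =
        (List.range' k l₁.length).reverse ++ acc := by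
    intro N l₁
    induction l₁ with
    | nil => intro k acc _; simp
    | cons b l ih =>
      intro k acc h
      simp only [List.length_cons] at h
      rw [List.foldl_cons, ih _ _ (by omega), List.length_cons, List.range'_succ]
      simp [show k ≤ N by omega]
  simp [key l.length l 0 [] (by omega), List.range_eq_range']

@[fun_prop]
theorem getD {l : α → List β} {i : α → ℕ} {d : β} (hl : PolyTime l) (hi : PolyTime i) :
    PolyTime (fun a => (l a).getD (i a) d) := by
  have main := foldl (α := List β × ℕ) (l := fun x => x.1) (c := fun _ => ((0 : ℕ), d))
    (F := fun x c b => (c.1 + 1, if c.1 = x.2 then b else c.2)) (.X + 2)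
    (fun a c b => by
      have h1 := Nat.size_le.2 (show c.1 + 1 < 2 ^ (Nat.size c.1 + 1) by
        have := Nat.lt_size_self c.1
        omega)
      simp only [len_nat, len_prod, Polynomial.eval_add, Polynomial.eval_X,
        Polynomial.eval_ofNat]
      split_ifs <;> omega) (by fun_prop) (by fun_prop) (by fun_prop)
  convert (main.comp (hl.prodMk hi)).snd using 2 with a
  generalize l a = l
  generalize i a = i
  have key : ∀ (l : List β) (k : ℕ) (r : β),
      (l.foldl (fun c b => (c.1 + 1, if c.1 = i then b else c.2)) (k, r)).2 =
        if i < k then r else l.getD (i - k) r := by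
    intro l
    induction l with
    | nil => simp
    | cons b l ih =>
      intro k r
      rw [List.foldl_cons, ih]
      rcases lt_trichotomy i k with h | rfl | h
      · simp [h, show i < k + 1 by omega, show k ≠ i by omega]
      · simp
      · obtain ⟨j, rfl⟩ := Nat.exists_eq_add_of_lt h
        simp [show k ≠ k + j + 1 by omega, show k + j + 1 - k = j + 1 by omega,
          show ¬ k + j + 1 < k by omega]
  simp [key]

-- The operation `fst` returns `0` on the code `0` of the empty list, which is exactly the default
-- value.
@[fun_prop]
theorem headD_zero {f : α → List ℕ} (hf : PolyTime f) : PolyTime (fun a => (f a).headD 0) :=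
  (of_op (f := fun l : List ℕ => l.headD 0) .fst fun l => by cases l <;> rfl).comp hf

@[fun_prop]
theorem decide_list_eq {f g : α → List ℕ} (hf : PolyTime f) (hg : PolyTime g) :
    PolyTime (fun a => decide (f a = g a)) := by
  -- The first list is traversed while the second is consumed; the flag stays `1` as long as the
  -- entries agree. The lists are equal if the flag survives and nothing is left of the second one.
  have main := foldl (α := List ℕ × List ℕ) (l := fun x => x.1) (c := fun x => (x.2, (1 : ℕ)))
    (F := fun _ c b => (c.1.tail, if c.2 = 1 ∧ c.1.length ≠ 0 ∧ c.1.headD 0 = b then 1 else 0)) 2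
    (fun a c b => by
      have h1 : len c.1.tail ≤ len c.1 := by
        cases c.1
        · simp
        · simp only [List.tail_cons, len_cons]; omega
      have h2 : Nat.size (if c.2 = 1 ∧ c.1.length ≠ 0 ∧ c.1.headD 0 = b then 1 else 0) ≤ 1 := by
        split_ifs <;> simp
      simp only [len_nat, len_prod, Polynomial.eval_ofNat]
      omega) (by fun_prop) (by fun_prop) (by fun_prop)
  have h := main.comp (hf.prodMk hg)
  convert (h.snd.decide_eq (const 1)).decide_and h.fst.length_ne_zero.decide_not using 2 with a
  rw [decide_eq_decide]
  dsimp only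
  generalize f a = l
  generalize g a = l'
  generalize hG : (fun (c : List ℕ × ℕ) (b : ℕ) => (c.1.tail,
    if c.2 = 1 ∧ c.1.length ≠ 0 ∧ c.1.headD 0 = b then 1 else 0)) = G
  have key0 : ∀ l l' : List ℕ, (l.foldl G (l', 0)).2 = 0 := by
    intro l
    induction l with
    | nil => simp
    | cons b l ih =>
      intro l'
      rw [List.foldl_cons, show G (l', 0) b = (l'.tail, 0) by simp [← hG], ih]
  induction l generalizing l' with
  | nil => cases l' <;> simp
  | cons b l ih =>
    rw [List.foldl_cons]
    cases l' with
    | nil => simp [show G ([], 1) b = ([], 0) by simp [← hG], key0]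
    | cons b' l' =>
      by_cases hb : b' = b
      · rw [show G (b' :: l', 1) b = (l', 1) by simp [← hG, hb]]
        simpa [hb] using ih l'
      · simp [show G (b' :: l', 1) b = (l', 0) by simp [← hG, hb], key0, Ne.symm hb]

-- One number is halved until it vanishes while another is doubled, so the exponential is obtained
-- in as many rounds as the argument has bits.
@[fun_prop]
theorem two_pow_size {f : α → ℕ} (hf : PolyTime f) : PolyTime (fun a => 2 ^ Nat.size (f a)) := by
  have key : ∀ (i x y : ℕ), (fun x : ℕ × ℕ => (x.1 / 2, 2 * x.2))^[i] (x, y) =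
      (x / 2 ^ i, 2 ^ i * y) := by
    intro i
    induction i with
    | zero => simp
    | succ i ih =>
      intro x y
      rw [Function.iterate_succ_apply, ih]
      ext
      · simp [Nat.div_div_eq_div_mul, pow_succ, mul_comm]
      · simp [pow_succ, mul_assoc]
  have main := iterate (c := fun x : ℕ × ℕ => decide (x.1 ≠ 0))
    (f := fun x : ℕ × ℕ => (x.1 / 2, 2 * x.2)) (fun x => Nat.size x.1) (2 * .X)
    (by fun_prop) (by fun_prop) ?_ ?_ ?_ ?_
  · convert (main.comp (hf.prodMk (const 1))).snd using 2 with a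
    simp [key]
  · intro x
    simp
    omega
  · rintro ⟨x, y⟩ i hi
    rw [key]
    have h1 : Nat.size (x / 2 ^ i) ≤ Nat.size x := Nat.size_le_size (Nat.div_le_self _ _)
    have h2 : Nat.size (2 ^ i * y) ≤ i + Nat.size y := by
      rw [Nat.size_le, pow_add]
      exact Nat.mul_lt_mul_of_pos_left (Nat.lt_size_self y) (by positivity)
    simp only [len_nat, len_prod, Polynomial.eval_mul, Polynomial.eval_ofNat,
      Polynomial.eval_X] at hi ⊢
    omega
  · rintro ⟨x, y⟩ i hi
    rw [key]
    have := Nat.lt_size.1 hi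
    simp only [decide_eq_true_eq]
    exact (Nat.div_pos this (by positivity)).ne'
  · rintro ⟨x, y⟩
    rw [key]
    simp [Nat.div_eq_of_lt (Nat.lt_size_self x)]

end PolyTime
end Lists
/-! ## The algorithm -/

/-- The decoded input: number of jobs, source, sink, processing times and edges, followed by the
budget and the numerator and denominator of the accuracy. -/
abbrev Input : Type :=
  (ℕ × ℕ × ℕ × List (ℕ × ℕ) × List (ℕ × ℕ × ℕ) × ℕ) × ℕ × ℕ × ℕ × ℕ

namespace Input

def source (d : Input) : ℕ := d.1.2.1
def sink (d : Input) : ℕ := d.1.2.2.1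
def jobs (d : Input) : List (ℕ × ℕ) := d.1.2.2.2.1
def edges (d : Input) : List (ℕ × ℕ × ℕ) := d.1.2.2.2.2.1
def budget (d : Input) : ℕ := d.2.1
def epsNum (d : Input) : ℕ := d.2.2.1
def epsDen (d : Input) : ℕ := d.2.2.2.1

/-- The precision of the rounding. -/
def accuracy (d : Input) : ℕ := d.jobs.length * (d.epsDen / d.epsNum + 2)

end Input

/-- A partial schedule: the list of triples (job, location, completion time) of the jobs that have
been scheduled, the most recent one first. Location `0` is the server, location `1` the cloud. -/
abbrev Partial : Type := List (ℕ × ℕ × ℕ)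

/-- Location and completion time of a job. The location of a job that is not scheduled is `2`. -/
def lookup (s : Partial) (j : ℕ) : ℕ × ℕ :=
  s.foldr (fun e r => if e.1 = j then e.2 else r) (2, 0)

def Done (s : Partial) (j : ℕ) : Prop := (lookup s j).1 ≠ 2

instance (s : Partial) (j : ℕ) : Decidable (Done s j) := instDecidableNot

/-- The job has a successor that is not scheduled. -/
def IsActive (d : Input) (s : Partial) (j : ℕ) : Prop := ∃ e ∈ d.edges, e.1 = j ∧ ¬ Done s e.2.1

instance (d : Input) (s : Partial) (j : ℕ) : Decidable (IsActive d s j) :=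
  inferInstanceAs (Decidable (∃ e ∈ d.edges, e.1 = j ∧ ¬ Done s e.2.1))

/-- What has to be remembered of a job. -/
def jobCode (d : Input) (s : Partial) (j : ℕ) : ℕ :=
  if Done s j then
    if IsActive d s j then 2 + 2 * (lookup s j).2 + (lookup s j).1 else 1
  else 0

/-- The time from which on the server is idle. -/
def ready (s : Partial) : ℕ := (s.map fun e => if e.2.1 = 0 then e.2.2 else 0).foldr max 0

/-- What has to be remembered of a partial schedule. -/
def key (d : Input) (s : Partial) : List ℕ :=
  ready s :: (List.range d.jobs.length).map (jobCode d s)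

def partialCost (d : Input) (s : Partial) : ℕ :=
  (s.map fun e => if e.2.1 = 1 then (d.jobs.getD e.1 (0, 0)).2 else 0).sum

/-- Rounding up to a number with few significant digits. -/
def roundUp (m t : ℕ) : ℕ :=
  (t + 2 ^ Nat.size (t / (2 * m)) - 1) / 2 ^ Nat.size (t / (2 * m)) * 2 ^ Nat.size (t / (2 * m))

def duration (d : Input) (j l : ℕ) : ℕ :=
  if l = 0 then (d.jobs.getD j (0, 0)).1 else (d.jobs.getD j (0, 0)).2

/-- The earliest possible start of a job at a location. -/
def start (d : Input) (s : Partial) (j l : ℕ) : ℕ :=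
  max (if l = 0 then ready s else 0) ((d.edges.map fun e =>
    if e.2.1 = j then (lookup s e.1).2 + (if (lookup s e.1).1 = l then 0 else e.2.2)
      else 0).foldr max 0)

def extend (d : Input) (s : Partial) (j l : ℕ) : Partial :=
  (j, l, roundUp d.accuracy (start d s j l + duration d j l)) :: s

/-- The partial schedule may be extended by the job at the location. -/
def Avail (d : Input) (s : Partial) (j l : ℕ) : Prop :=
  ¬ Done s j ∧ (∀ e ∈ d.edges, e.2.1 = j → Done s e.1) ∧
    (l = 0 ∨ ¬ (j = d.source ∨ j = d.sink)) ∧ partialCost d (extend d s j l) ≤ d.budget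

instance (d : Input) (s : Partial) (j l : ℕ) : Decidable (Avail d s j l) :=
  instDecidableAnd

def successors (d : Input) (s : Partial) : List Partial :=
  (List.range d.jobs.length).flatMap fun j => [0, 1].flatMap fun l =>
    if Avail d s j l then [extend d s j l] else []

/-- Adds a partial schedule unless there is an equivalent one that is at least as cheap. -/
def insertCheapest (d : Input) (s : Partial) (L : List Partial) : List Partial :=
  if ∃ t ∈ L, key d t = key d s ∧ partialCost d t ≤ partialCost d s then L
  else s :: L.filter fun t => ¬ key d t = key d s

def prune (d : Input) (L : List Partial) : List Partial := L.foldr (insertCheapest d) []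

def nextLayer (d : Input) (L : List Partial) : List Partial :=
  prune d (L.flatMap (successors d))

/-- A partial schedule for which the server is idle as early as possible. -/
def best (L : List Partial) : Partial :=
  L.foldr (fun s r => if ¬ r.length ≠ 0 ∨ ready s ≤ ready r then s else r) []

def firstLayer (d : Input) : List Partial := [[(d.source, 0, 0)]]

def output (d : Input) (s : Partial) : List (ℕ × ℕ) :=
  (List.range d.jobs.length).map (lookup s)

/-! ### One round of the dynamic program takes polynomial time -/

namespace PolyTime

variable {α β : Type} [Coded α] [Coded β]

@[fun_prop]
theorem sum {l : α → List ℕ} (hl : PolyTime l) : PolyTime (fun a => (l a).sum) := by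
  refine foldr (F := fun (_ : α) (b c : ℕ) => b + c) (.X + 1) (fun a b c => ?_) hl (const 0)
    (by fun_prop)
  have h : Nat.size (b + c) ≤ Nat.size b + Nat.size c := size_add_le b c
  simp only [len_nat, Polynomial.eval_add, Polynomial.eval_X, Polynomial.eval_one]
  omega

@[fun_prop]
theorem foldr_max {l : α → List ℕ} (hl : PolyTime l) :
    PolyTime (fun a => (l a).foldr Max.max 0) := by
  refine foldr (F := fun (_ : α) (b c : ℕ) => Max.max b c) (.X + 1) (fun a b c => ?_) hl (const 0)
    (by fun_prop)
  simp only [len_nat, Polynomial.eval_add, Polynomial.eval_X, Polynomial.eval_one]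
  rcases max_choice b c with h | h <;> rw [h] <;> omega

variable {d : α → Input} {s : α → Partial} {j l : α → ℕ}

@[fun_prop]
theorem source (hd : PolyTime d) : PolyTime (fun a => (d a).source) := by
  unfold Input.source; fun_prop

@[fun_prop]
theorem sink (hd : PolyTime d) : PolyTime (fun a => (d a).sink) := by
  unfold Input.sink; fun_prop

@[fun_prop]
theorem jobs (hd : PolyTime d) : PolyTime (fun a => (d a).jobs) := by
  unfold Input.jobs; fun_prop

@[fun_prop]
theorem edges (hd : PolyTime d) : PolyTime (fun a => (d a).edges) := by
  unfold Input.edges; fun_prop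

@[fun_prop]
theorem budget (hd : PolyTime d) : PolyTime (fun a => (d a).budget) := by
  unfold Input.budget; fun_prop

@[fun_prop]
theorem accuracy (hd : PolyTime d) : PolyTime (fun a => (d a).accuracy) := by
  unfold Input.accuracy Input.epsDen Input.epsNum; fun_prop

@[fun_prop]
theorem lookup (hs : PolyTime s) (hj : PolyTime j) :
    PolyTime (fun a => lookup (s a) (j a)) := by
  refine foldr (F := fun a e r => if e.1 = j a then e.2 else r) .X (fun a b c => ?_) hs (const _) ?_
  · split_ifs
    · simp; omega
    · simp
  · have : PolyTime fun x : α × (ℕ × ℕ × ℕ) × ℕ × ℕ => j x.1 := hj.comp (by fun_prop)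
    fun_prop

@[fun_prop]
theorem done (hs : PolyTime s) (hj : PolyTime j) :
    PolyTime (fun a => decide (Done (s a) (j a))) := by
  have : PolyTime fun a => decide (¬ (ServerCloud.lookup (s a) (j a)).1 = 2) := by fun_prop
  exact this

@[fun_prop]
theorem isActive (hd : PolyTime d) (hs : PolyTime s) (hj : PolyTime j) :
    PolyTime (fun a => decide (IsActive (d a) (s a) (j a))) := by
  refine decide_exists (P := fun a e => e.1 = j a ∧ ¬ Done (s a) e.2.1) hd.edges ?_
  have h₁ : PolyTime fun x : α × ℕ × ℕ × ℕ => j x.1 := hj.comp (by fun_prop)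
  have h₂ : PolyTime fun x : α × ℕ × ℕ × ℕ => s x.1 := hs.comp (by fun_prop)
  fun_prop

@[fun_prop]
theorem jobCode (hd : PolyTime d) (hs : PolyTime s) (hj : PolyTime j) :
    PolyTime (fun a => jobCode (d a) (s a) (j a)) := by
  unfold ServerCloud.jobCode; fun_prop

@[fun_prop]
theorem ready (hs : PolyTime s) : PolyTime (fun a => ready (s a)) :=
  foldr_max (map (F := fun _ e => if e.2.1 = 0 then e.2.2 else 0) hs (by fun_prop))

@[fun_prop]
theorem key (hd : PolyTime d) (hs : PolyTime s) : PolyTime (fun a => key (d a) (s a)) := by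
  refine hs.ready.cons (map hd.jobs.range_length ?_)
  have h₁ : PolyTime fun x : α × ℕ => d x.1 := hd.comp (by fun_prop)
  have h₂ : PolyTime fun x : α × ℕ => s x.1 := hs.comp (by fun_prop)
  fun_prop

@[fun_prop]
theorem partialCost (hd : PolyTime d) (hs : PolyTime s) :
    PolyTime (fun a => partialCost (d a) (s a)) := by
  refine sum (map (F := fun a e => if e.2.1 = 1 then ((d a).jobs.getD e.1 (0, 0)).2 else 0) hs ?_)
  have h₁ : PolyTime fun x : α × ℕ × ℕ × ℕ => d x.1 := hd.comp (by fun_prop)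
  fun_prop

@[fun_prop]
theorem roundUp (hj : PolyTime j) (hl : PolyTime l) :
    PolyTime (fun a => roundUp (j a) (l a)) := by
  unfold ServerCloud.roundUp; fun_prop

@[fun_prop]
theorem duration (hd : PolyTime d) (hj : PolyTime j) (hl : PolyTime l) :
    PolyTime (fun a => duration (d a) (j a) (l a)) := by
  unfold ServerCloud.duration; fun_prop

@[fun_prop]
theorem start (hd : PolyTime d) (hs : PolyTime s) (hj : PolyTime j) (hl : PolyTime l) :
    PolyTime (fun a => start (d a) (s a) (j a) (l a)) := by
  refine PolyTime.max (by fun_prop) (foldr_max (map (F := fun a e =>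
    if e.2.1 = j a then (ServerCloud.lookup (s a) e.1).2 +
      (if (ServerCloud.lookup (s a) e.1).1 = l a then 0 else e.2.2) else 0) hd.edges ?_))
  have h₁ : PolyTime fun x : α × ℕ × ℕ × ℕ => j x.1 := hj.comp (by fun_prop)
  have h₂ : PolyTime fun x : α × ℕ × ℕ × ℕ => s x.1 := hs.comp (by fun_prop)
  have h₃ : PolyTime fun x : α × ℕ × ℕ × ℕ => l x.1 := hl.comp (by fun_prop)
  fun_prop

@[fun_prop]
theorem extend (hd : PolyTime d) (hs : PolyTime s) (hj : PolyTime j) (hl : PolyTime l) :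
    PolyTime (fun a => extend (d a) (s a) (j a) (l a)) := by
  unfold ServerCloud.extend; fun_prop

@[fun_prop]
theorem avail (hd : PolyTime d) (hs : PolyTime s) (hj : PolyTime j) (hl : PolyTime l) :
    PolyTime (fun a => decide (Avail (d a) (s a) (j a) (l a))) := by
  have h : PolyTime fun a => decide (∀ e ∈ (d a).edges, e.2.1 = j a → Done (s a) e.1) := by
    refine decide_forall (P := fun a e => e.2.1 = j a → Done (s a) e.1) hd.edges ?_
    have h₁ : PolyTime fun x : α × ℕ × ℕ × ℕ => j x.1 := hj.comp (by fun_prop)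
    have h₂ : PolyTime fun x : α × ℕ × ℕ × ℕ => s x.1 := hs.comp (by fun_prop)
    fun_prop
  have h' : PolyTime fun a => decide (¬ Done (s a) (j a) ∧
      (∀ e ∈ (d a).edges, e.2.1 = j a → Done (s a) e.1) ∧
        (l a = 0 ∨ ¬ (j a = (d a).source ∨ j a = (d a).sink)) ∧
          ServerCloud.partialCost (d a) (ServerCloud.extend (d a) (s a) (j a) (l a)) ≤
            (d a).budget) := by
    fun_prop
  exact h'

@[fun_prop]
theorem successors (hd : PolyTime d) (hs : PolyTime s) :
    PolyTime (fun a => successors (d a) (s a)) := by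
  refine flatMap hd.jobs.range_length (flatMap (F := fun (x : α × ℕ) l =>
    if Avail (d x.1) (s x.1) x.2 l then [ServerCloud.extend (d x.1) (s x.1) x.2 l] else [])
      (const [0, 1]) ?_)
  have h₁ : PolyTime fun x : (α × ℕ) × ℕ => d x.1.1 := hd.comp (by fun_prop)
  have h₂ : PolyTime fun x : (α × ℕ) × ℕ => s x.1.1 := hs.comp (by fun_prop)
  fun_prop

variable {L : α → List Partial}

@[fun_prop]
theorem insertCheapest (hd : PolyTime d) (hs : PolyTime s) (hL : PolyTime L) :
    PolyTime (fun a => insertCheapest (d a) (s a) (L a)) := by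
  have h₁ : PolyTime fun x : α × Partial => d x.1 := hd.comp (by fun_prop)
  have h₂ : PolyTime fun x : α × Partial => s x.1 := hs.comp (by fun_prop)
  refine ite (decide_exists (P := fun a t => ServerCloud.key (d a) t = ServerCloud.key (d a) (s a) ∧
    ServerCloud.partialCost (d a) t ≤ ServerCloud.partialCost (d a) (s a)) hL ?_) hL
    (hs.cons (hL.filter (P := fun a t =>
      decide (¬ ServerCloud.key (d a) t = ServerCloud.key (d a) (s a))) ?_)) <;> fun_prop

theorem len_filter_le (P : β → Bool) (l : List β) : len (l.filter P) ≤ len l := by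
  induction l with
  | nil => simp
  | cons b l ih =>
    rw [List.filter_cons]
    split_ifs <;> simp only [len_cons] <;> omega

@[fun_prop]
theorem prune (hd : PolyTime d) (hL : PolyTime L) : PolyTime (fun a => prune (d a) (L a)) := by
  refine foldr (.X + 1) (fun a s L => ?_) hL (const []) ?_
  · have := len_filter_le
      (fun t => decide (¬ ServerCloud.key (d a) t = ServerCloud.key (d a) s)) L
    rw [ServerCloud.insertCheapest, Polynomial.eval_add, Polynomial.eval_X, Polynomial.eval_one]
    split_ifs
    · omega
    · rw [len_cons]; omega
  · have h₁ : PolyTime fun x : α × Partial × List Partial => d x.1 := hd.comp (by fun_prop)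
    fun_prop

@[fun_prop]
theorem nextLayer (hd : PolyTime d) (hL : PolyTime L) :
    PolyTime (fun a => nextLayer (d a) (L a)) := by
  refine hd.prune (flatMap hL ?_)
  have h₁ : PolyTime fun x : α × Partial => d x.1 := hd.comp (by fun_prop)
  fun_prop

@[fun_prop]
theorem best (hL : PolyTime L) : PolyTime (fun a => best (L a)) := by
  refine foldr (F := fun (_ : α) (s r : Partial) =>
    if ¬ r.length ≠ 0 ∨ ServerCloud.ready s ≤ ServerCloud.ready r then s else r) .X
    (fun a s r => ?_) hL (const []) (by fun_prop)
  rw [Polynomial.eval_X]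
  split_ifs <;> omega

@[fun_prop]
theorem firstLayer (hd : PolyTime d) : PolyTime (fun a => firstLayer (d a)) := by
  unfold ServerCloud.firstLayer; fun_prop

@[fun_prop]
theorem output (hd : PolyTime d) (hs : PolyTime s) : PolyTime (fun a => output (d a) (s a)) := by
  refine map hd.jobs.range_length ?_
  have h₁ : PolyTime fun x : α × ℕ => s x.1 := hs.comp (by fun_prop)
  fun_prop

end PolyTime

/-! ## Partial schedules -/

/-! ### Rounding to few significant binary digits -/

section Rounding

theorem le_roundUp (m t : ℕ) : t ≤ roundUp m t := by
  unfold roundUp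
  generalize hδ : 2 ^ Nat.size (t / (2 * m)) = δ
  have h0 : 0 < δ := hδ ▸ by positivity
  have h1 := Nat.div_add_mod (t + δ - 1) δ
  have h2 := Nat.mod_lt (t + δ - 1) h0
  rw [mul_comm] at h1
  omega

/-- If `t < 2m`, the grid width is `1` and nothing changes. Otherwise the width is twice a power of
two that is at most `t / (2m)`, hence at most `t / m`, and rounding up adds less than the width. -/
theorem mul_roundUp_le {m : ℕ} (hm : 0 < m) (t : ℕ) : m * roundUp m t ≤ (m + 1) * t := by
  unfold roundUp
  rcases Nat.eq_zero_or_pos (Nat.size (t / (2 * m))) with h | h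
  · simp only [h, pow_zero, Nat.add_sub_cancel, Nat.div_one, mul_one]
    nlinarith
  · have h1 : 2 ^ (Nat.size (t / (2 * m)) - 1) ≤ t / (2 * m) := Nat.lt_size.1 (by omega)
    rw [Nat.le_div_iff_mul_le (by positivity)] at h1
    have h2 : 2 ^ Nat.size (t / (2 * m)) = 2 * 2 ^ (Nat.size (t / (2 * m)) - 1) := by
      rw [← pow_succ', Nat.sub_add_cancel h]
    generalize 2 ^ Nat.size (t / (2 * m)) = δ at *
    have h3 := Nat.div_mul_le_self (t + δ - 1) δ
    nlinarith [show t + δ - 1 ≤ t + δ by omega]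

/-- The width `δ` exceeds `t / (2m)`, so `t < 2mδ` and the rounded value is at most `2m` multiples
of `δ`. -/
theorem roundUp_eq {m : ℕ} (hm : 0 < m) (t : ℕ) :
    ∃ a ≤ 2 * m, ∃ e ≤ Nat.size t, roundUp m t = a * 2 ^ e := by
  refine ⟨_, ?_, _, Nat.size_le_size (Nat.div_le_self t (2 * m)), rfl⟩
  have h := Nat.lt_size_self (t / (2 * m))
  rw [Nat.div_lt_iff_lt_mul (by positivity)] at h
  generalize 2 ^ Nat.size (t / (2 * m)) = δ at *
  have h0 : 0 < δ := by by_contra h0; simp [show δ = 0 by omega] at h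
  rw [← Nat.lt_succ_iff, Nat.div_lt_iff_lt_mul h0, Nat.succ_mul, mul_comm (2 * m)]
  omega

end Rounding

theorem foldr_max_cases (l : List ℕ) : l.foldr max 0 = 0 ∨ l.foldr max 0 ∈ l := by
  induction l with
  | nil => simp
  | cons a l ih =>
    rw [List.foldr_cons]
    rcases max_choice a (l.foldr max 0) with h | h <;> rw [h]
    · simp
    · exact ih.imp_right fun h => by simp [h]

theorem le_foldr_max {l : List ℕ} {a : ℕ} (h : a ∈ l) : a ≤ l.foldr max 0 := by
  induction l with
  | nil => simp at h
  | cons b l ih =>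
    rcases List.mem_cons.1 h with rfl | h
    · exact le_max_left _ _
    · exact (ih h).trans (le_max_right _ _)

theorem lookup_cons (e : ℕ × ℕ × ℕ) (s : Partial) (j : ℕ) :
    lookup (e :: s) j = if e.1 = j then e.2 else lookup s j := rfl

theorem lookup_extend (d : Input) (s : Partial) (j l i : ℕ) : lookup (extend d s j l) i =
    if j = i then (l, roundUp d.accuracy (start d s j l + duration d j l)) else lookup s i := rfl

theorem ready_extend (d : Input) (s : Partial) (j l : ℕ) : ready (extend d s j l) =
    max (if l = 0 then roundUp d.accuracy (start d s j l + duration d j l) else 0) (ready s) := rfl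

theorem partialCost_extend (d : Input) (s : Partial) (j l : ℕ) : partialCost d (extend d s j l) =
    (if l = 1 then (d.jobs.getD j (0, 0)).2 else 0) + partialCost d s := rfl

/-- The partial schedules that the algorithm can generate. -/
inductive Reach (d : Input) : Partial → Prop
  | base : Reach d [(d.source, 0, 0)]
  | step {s : Partial} {j l : ℕ} : Reach d s → j < d.jobs.length → l < 2 → Avail d s j l →
      Reach d (extend d s j l)

theorem mem_successors {d : Input} {s t : Partial} : t ∈ successors d s ↔
    ∃ j < d.jobs.length, ∃ l < 2, Avail d s j l ∧ t = extend d s j l := by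
  simp only [successors, List.mem_flatMap, List.mem_range, List.mem_cons, List.not_mem_nil,
    or_false, List.mem_ite_nil_right]
  constructor
  · rintro ⟨j, hj, l, hl, h⟩
    exact ⟨j, hj, l, by omega, h⟩
  · rintro ⟨j, hj, l, hl, h⟩
    exact ⟨j, hj, l, by omega, h⟩

theorem mem_insertCheapest {d : Input} {s t : Partial} {L : List Partial}
    (h : t ∈ insertCheapest d s L) : t = s ∨ t ∈ L := by
  unfold insertCheapest at h
  split_ifs at h
  · exact .inr h
  · simp only [List.mem_cons, List.mem_filter] at h
    tauto

theorem mem_of_mem_prune {d : Input} {t : Partial} {L : List Partial} (h : t ∈ prune d L) :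
    t ∈ L := by
  induction L with
  | nil => exact h
  | cons s L ih =>
    rcases mem_insertCheapest h with rfl | h
    · simp
    · simp [ih h]

theorem exists_mem_prune {d : Input} {s : Partial} {L : List Partial} (h : s ∈ L) :
    ∃ t ∈ prune d L, key d t = key d s ∧ partialCost d t ≤ partialCost d s := by
  have hins : ∀ (s : Partial) (L : List Partial),
      ∃ t ∈ insertCheapest d s L, key d t = key d s ∧ partialCost d t ≤ partialCost d s := by
    intro s L
    unfold insertCheapest
    split_ifs with hs
    · exact hs
    · exact ⟨s, by simp, rfl, le_rfl⟩
  -- An old entry can be dropped only if the new one has the same key. If the new one is at least as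
  -- cheap, `hins` provides a substitute; if it is dearer, the insertion leaves the list unchanged.
  have hkeep : ∀ (s t : Partial) (L : List Partial), t ∈ L →
      ∃ t' ∈ insertCheapest d s L, key d t' = key d t ∧ partialCost d t' ≤ partialCost d t := by
    intro s t L ht
    by_cases hk : key d t = key d s
    · by_cases hc : partialCost d s ≤ partialCost d t
      · obtain ⟨t', h1, h2, h3⟩ := hins s L
        exact ⟨t', h1, h2.trans hk.symm, h3.trans hc⟩
      · refine ⟨t, ?_, rfl, le_rfl⟩
        rw [insertCheapest, if_pos ⟨t, ht, hk, by omega⟩]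
        exact ht
    · refine ⟨t, ?_, rfl, le_rfl⟩
      unfold insertCheapest
      split_ifs
      · exact ht
      · simp [ht, hk]
  induction L with
  | nil => simp at h
  | cons s' L ih =>
    change ∃ t ∈ insertCheapest d s' (prune d L), _
    rcases List.mem_cons.1 h with rfl | h
    · exact hins _ _
    · obtain ⟨t, h1, h2, h3⟩ := ih h
      obtain ⟨t', h1', h2', h3'⟩ := hkeep s' t _ h1
      exact ⟨t', h1', h2'.trans h2, h3'.trans h3⟩

/-- This is what turns a bound on the number of keys into a bound on the length of a layer. -/
theorem nodup_map_key_prune (d : Input) (L : List Partial) :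
    ((prune d L).map (key d)).Nodup := by
  induction L with
  | nil => simp [prune]
  | cons s L ih =>
    change ((insertCheapest d s (prune d L)).map (key d)).Nodup
    unfold insertCheapest
    split_ifs
    · exact ih
    · rw [List.map_cons, List.nodup_cons]
      constructor
      · simp
      · exact ih.sublist (List.filter_sublist.map _)

/-- The partial schedules with `m + 1` jobs that the algorithm keeps. -/
def layer (d : Input) (m : ℕ) : List Partial := (nextLayer d)^[m] (firstLayer d)

theorem layer_succ (d : Input) (m : ℕ) : layer d (m + 1) = nextLayer d (layer d m) :=
  Function.iterate_succ_apply' _ _ _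

theorem nodup_map_key_layer (d : Input) (m : ℕ) : ((layer d m).map (key d)).Nodup := by
  cases m with
  | zero => simp [layer, firstLayer]
  | succ m => rw [layer_succ]; exact nodup_map_key_prune _ _

theorem reach_of_mem_layer {d : Input} {m : ℕ} {s : Partial} (h : s ∈ layer d m) :
    Reach d s ∧ s.length = m + 1 := by
  induction m generalizing s with
  | zero =>
    obtain rfl : s = [(d.source, 0, 0)] := by simpa [layer, firstLayer] using h
    exact ⟨.base, rfl⟩
  | succ m ih =>
    rw [layer_succ] at h
    obtain ⟨t, ht, hs⟩ := List.mem_flatMap.1 (mem_of_mem_prune h)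
    obtain ⟨j, hj, l, hl, ha, rfl⟩ := mem_successors.1 hs
    obtain ⟨h1, h2⟩ := ih ht
    exact ⟨.step h1 hj hl ha, by simp [extend, h2]⟩

theorem exists_mem_layer_succ {d : Input} {m : ℕ} {s : Partial} (h : s ∈ layer d m) {j l : ℕ}
    (hj : j < d.jobs.length) (hl : l < 2) (ha : Avail d s j l) :
    ∃ t ∈ layer d (m + 1), key d t = key d (extend d s j l) ∧
      partialCost d t ≤ partialCost d (extend d s j l) := by
  rw [layer_succ]
  exact exists_mem_prune (List.mem_flatMap.2 ⟨s, h, mem_successors.2 ⟨j, hj, l, hl, ha, rfl⟩⟩)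

/-- The empty partial schedule serves as the mark for "no candidate yet" in the fold, so it must not
occur in the list itself. -/
theorem best_spec {L : List Partial} (hL : L ≠ []) (hne : ∀ s ∈ L, s ≠ []) :
    best L ∈ L ∧ ∀ t ∈ L, ready (best L) ≤ ready t := by
  induction L with
  | nil => exact absurd rfl hL
  | cons s L ih =>
    have hb : best (s :: L) =
        if ¬ (best L).length ≠ 0 ∨ ready s ≤ ready (best L) then s else best L := rfl
    rcases eq_or_ne L [] with rfl | hL'
    · have : best [s] = s := by rw [hb]; simp [best]
      simp [this]
    · obtain ⟨h1, h2⟩ := ih hL' fun s hs => hne s (by simp [hs])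
      have h3 : (best L).length ≠ 0 := by
        simpa using hne _ (List.mem_cons_of_mem _ h1)
      rw [hb]
      split_ifs with h
      · have h4 : ready s ≤ ready (best L) := h.resolve_left (not_not.2 h3)
        refine ⟨by simp, fun t ht => ?_⟩
        rcases List.mem_cons.1 ht with rfl | ht
        · exact le_rfl
        · exact h4.trans (h2 t ht)
      · push Not at h
        refine ⟨by simp [h1], fun t ht => ?_⟩
        rcases List.mem_cons.1 ht with rfl | ht
        · exact h.2.le
        · exact h2 t ht

/-- Well-formed inputs. -/
structure Input.WellFormed (d : Input) : Prop where
  source_lt : d.source < d.jobs.length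
  sink_lt : d.sink < d.jobs.length
  edges_lt : ∀ e ∈ d.edges, e.1 < d.jobs.length ∧ e.2.1 < d.jobs.length
  acyclic : ∃ r : ℕ → ℕ, ∀ e ∈ d.edges, r e.1 < r e.2.1
  source_min : ∀ e ∈ d.edges, e.2.1 ≠ d.source
  exists_pred : ∀ j < d.jobs.length, j ≠ d.source → ∃ e ∈ d.edges, e.2.1 = j
  exists_succ : ∀ j < d.jobs.length, j ≠ d.sink → ∃ e ∈ d.edges, e.1 = j
  duration_source : duration d d.source 0 = 0
  accuracy_pos : 0 < d.accuracy

/-! ### Invariants of generated partial schedules -/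

namespace Reach

variable {d : Input} {s : Partial}

theorem lookup_lt (h : Reach d s) (j : ℕ) : (lookup s j).1 < 2 ∨ lookup s j = (2, 0) := by
  induction h with
  | base =>
    rw [lookup_cons]
    split_ifs
    · simp
    · exact .inr rfl
  | step _ _ hl _ ih =>
    rw [lookup_extend]
    split_ifs
    · exact .inl hl
    · exact ih

theorem done_iff (h : Reach d s) (j : ℕ) : Done s j ↔ (lookup s j).1 < 2 := by
  unfold Done
  rcases h.lookup_lt j with h | h
  · omega
  · simp [h]

theorem done_extend {d : Input} {s : Partial} {i j l : ℕ} (hl : l < 2) :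
    Done (extend d s j l) i ↔ i = j ∨ Done s i := by
  unfold Done
  rw [lookup_extend]
  split_ifs with h
  · simp [h]; omega
  · simp [Ne.symm h]

theorem lt_of_done (hd : d.WellFormed) (h : Reach d s) {j : ℕ} (hj : Done s j) :
    j < d.jobs.length := by
  induction h with
  | base =>
    by_cases h : d.source = j
    · exact h ▸ hd.source_lt
    · simp [Done, lookup, h] at hj
  | step _ hj' hl _ ih =>
    rcases (done_extend hl).1 hj with rfl | hj
    · exact hj'
    · exact ih hj

theorem done_source (h : Reach d s) : Done s d.source := by
  induction h with
  | base => simp [Done, lookup]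
  | step _ _ hl _ ih => exact (done_extend hl).2 (.inr ih)

theorem location_eq_one (h : Reach d s) {j : ℕ} (hj : (lookup s j).1 = 1) :
    j ≠ d.source ∧ j ≠ d.sink := by
  induction h with
  | base =>
    by_cases h : d.source = j <;> simp [lookup, h] at hj
  | @step s x l _ _ hl ha ih =>
    rw [lookup_extend] at hj
    split_ifs at hj with h
    · obtain ⟨-, -, h', -⟩ := ha
      have hl1 : l = 1 := hj
      subst h
      have := h'.resolve_left (by omega)
      tauto
    · exact ih hj

/-- The start of a new job respects all incoming edges, and rounding only postpones its completion.
Earlier entries stay untouched because an appended job was not done before. -/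
theorem precedence (hd : d.WellFormed) (h : Reach d s) {e : ℕ × ℕ × ℕ} (he : e ∈ d.edges)
    (hj : Done s e.2.1) : Done s e.1 ∧ (lookup s e.1).2 +
      (if (lookup s e.1).1 = (lookup s e.2.1).1 then 0 else e.2.2) +
        duration d e.2.1 (lookup s e.2.1).1 ≤ (lookup s e.2.1).2 := by
  induction h with
  | base =>
    exfalso
    have := hd.source_min e he
    simp [Done, lookup, Ne.symm this] at hj
  | @step s j l hs _ hl ha ih =>
    rw [done_extend hl] at hj ⊢
    have e0 : Done s e.1 → lookup (extend d s j l) e.1 = lookup s e.1 := fun h1 => by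
      rw [lookup_extend, if_neg]
      rintro rfl
      exact ha.1 h1
    by_cases h : e.2.1 = j
    · have h1 := ha.2.1 e he h
      refine ⟨.inr h1, ?_⟩
      have e1 : lookup (extend d s j l) e.2.1 =
        (l, roundUp d.accuracy (start d s j l + duration d j l)) := by
        rw [lookup_extend, if_pos h.symm]
      rw [e0 h1, e1, h]
      refine le_trans ?_ (le_roundUp _ _)
      gcongr
      refine le_trans ?_ (le_max_right _ _)
      exact le_foldr_max (List.mem_map.2 ⟨e, he, by simp [h]⟩)
    · obtain ⟨h1, h2⟩ := ih (hj.resolve_left h)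
      refine ⟨.inr h1, ?_⟩
      have e1 : lookup (extend d s j l) e.2.1 = lookup s e.2.1 := by
        rw [lookup_extend, if_neg (Ne.symm h)]
      rwa [e0 h1, e1]

theorem le_ready (h : Reach d s) {j : ℕ} (hj : (lookup s j).1 = 0) :
    (lookup s j).2 ≤ ready s := by
  induction h with
  | base =>
    by_cases h : d.source = j
    · simp [lookup, h]
    · simp [lookup, h] at hj
  | step _ _ hl ha ih =>
    rw [lookup_extend] at hj
    rw [ready_extend, lookup_extend]
    split_ifs at hj ⊢ with h h'
    · exact le_max_left _ _
    · simp at hj; omega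
    · exact (ih hj).trans (le_max_right _ _)
    · exact (ih hj).trans (le_max_right _ _)

theorem sequential (h : Reach d s) {i j : ℕ} (hi : (lookup s i).1 = 0)
    (hj : (lookup s j).1 = 0) (hij : i ≠ j) :
    (lookup s i).2 + duration d j 0 ≤ (lookup s j).2 ∨
      (lookup s j).2 + duration d i 0 ≤ (lookup s i).2 := by
  induction h with
  | base =>
    have h1 : d.source = i := by
      by_contra h
      simp [lookup, h] at hi
    have h2 : d.source = j := by
      by_contra h
      simp [lookup, h] at hj
    omega
  | @step s x l hs _ hl ha ih =>
    have key : ∀ i, l = 0 → (lookup s i).1 = 0 → (lookup s i).2 + duration d x 0 ≤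
        roundUp d.accuracy (start d s x l + duration d x l) := by
      rintro i rfl hi
      refine le_trans ?_ (le_roundUp _ _)
      gcongr
      exact (hs.le_ready hi).trans (le_max_left _ _)
    simp only [lookup_extend] at hi hj ⊢
    by_cases h1 : x = i <;> by_cases h2 : x = j
    · omega
    · subst h1
      simp only [if_true, h2, if_false] at hi hj ⊢
      exact .inr (key _ hi hj)
    · subst h2
      simp only [if_true, h1, if_false] at hi hj ⊢
      exact .inl (key _ hj hi)
    · simp only [h1, h2, if_false] at hi hj ⊢
      exact ih hi hj

/-- No job is appended twice, so the sum along the list is a sum over jobs. -/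
theorem partialCost_eq (h : Reach d s) : partialCost d s =
    ∑ j ∈ Finset.range d.jobs.length, if (lookup s j).1 = 1 then duration d j 1 else 0 := by
  induction h with
  | base =>
    rw [Finset.sum_eq_zero]
    · simp [partialCost]
    · intro j _
      by_cases h : d.source = j <;> simp [lookup, h]
  | @step s x l hs hx hl ha ih =>
    have h1 : ∀ j, (if (lookup (extend d s x l) j).1 = 1 then duration d j 1 else 0) =
        (if x = j then (if l = 1 then (d.jobs.getD x (0, 0)).2 else 0) else 0) +
          if (lookup s j).1 = 1 then duration d j 1 else 0 := by
      intro j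
      by_cases h : x = j
      · have e1 : lookup (extend d s x l) j =
          (l, roundUp d.accuracy (start d s x l + duration d x l)) := by
          rw [lookup_extend, if_pos h]
        have e2 : (lookup s j).1 = 2 := h ▸ not_not.1 ha.1
        rw [e1, e2, if_pos h, h]
        rfl
      · rw [lookup_extend, if_neg h, if_neg h, zero_add]
    rw [partialCost_extend, ih, Finset.sum_congr rfl fun j _ => h1 j, Finset.sum_add_distrib,
      Finset.sum_ite_eq, if_pos (Finset.mem_range.2 hx)]

theorem partialCost_le (h : Reach d s) : partialCost d s ≤ d.budget := by
  induction h with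
  | base => simp [partialCost]
  | step _ _ _ ha _ => exact ha.2.2.2

theorem card_done (hd : d.WellFormed) (h : Reach d s) :
    ((Finset.range d.jobs.length).filter (Done s)).card = s.length := by
  induction h with
  | base =>
    rw [List.length_singleton, Finset.card_eq_one]
    refine ⟨d.source, Finset.ext fun j => ?_⟩
    simp only [Finset.mem_filter, Finset.mem_range, Finset.mem_singleton]
    constructor
    · rintro ⟨-, h⟩
      by_contra h'
      simp [Done, lookup, Ne.symm h'] at h
    · rintro rfl
      exact ⟨hd.source_lt, by simp [Done, lookup]⟩
  | @step s x l hs hx hl ha ih =>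
    rw [extend, List.length_cons, ← ih, ← Finset.card_insert_of_notMem (a := x)]
    · congr 1
      ext j
      simp only [Finset.mem_filter, Finset.mem_range, Finset.mem_insert]
      have := done_extend (d := d) (s := s) (i := j) (j := x) hl
      rw [extend] at this
      rw [this]
      constructor
      · tauto
      · rintro (rfl | h)
        · tauto
        · tauto
    · simp [ha.1]

theorem done_of_length (hd : d.WellFormed) (h : Reach d s) (hs : s.length = d.jobs.length) {j : ℕ}
    (hj : j < d.jobs.length) : Done s j := by
  have h1 := h.card_done hd
  rw [hs] at h1
  have h2 := (Finset.card_filter_eq_iff (s := Finset.range d.jobs.length) (p := Done s)).1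
    (by simpa using h1)
  exact h2 j (Finset.mem_range.2 hj)

theorem exists_not_done (hd : d.WellFormed) (h : Reach d s) (hs : s.length < d.jobs.length) :
    ∃ j < d.jobs.length, ¬ Done s j := by
  by_contra! h'
  have h1 := h.card_done hd
  rw [Finset.filter_true_of_mem fun j hj => h' j (Finset.mem_range.1 hj)] at h1
  simp at h1
  omega

end Reach

/-- An undone job of least topological rank has all its predecessors done, and on the server it
costs nothing, so it can always be appended within the budget. -/
theorem layer_ne_nil {d : Input} (hd : d.WellFormed) {m : ℕ} (hm : m < d.jobs.length) :
    layer d m ≠ [] := by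
  induction m with
  | zero => simp [layer, firstLayer]
  | succ m ih =>
    obtain ⟨s, hs⟩ := List.exists_mem_of_ne_nil _ (ih (by omega))
    obtain ⟨h1, h2⟩ := reach_of_mem_layer hs
    obtain ⟨j₀, hj₀, hj₀'⟩ := h1.exists_not_done hd (by omega)
    obtain ⟨r, hr⟩ := hd.acyclic
    obtain ⟨j, hj, hmin⟩ := Finset.exists_min_image
      ((Finset.range d.jobs.length).filter fun j => ¬ Done s j) r
      ⟨j₀, by simp [hj₀, hj₀']⟩
    simp only [Finset.mem_filter, Finset.mem_range] at hj hmin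
    obtain ⟨t, ht, -⟩ := exists_mem_layer_succ hs hj.1 (l := 0) (by norm_num)
      ⟨hj.2, fun e he hej => by
      by_contra hdone
      have h3 := hmin e.1 ⟨(hd.edges_lt e he).1, hdone⟩
      have h4 := hr e he
      rw [hej] at h4
      omega, .inl rfl, by
        rw [partialCost_extend]
        simpa using h1.partialCost_le⟩
    exact List.ne_nil_of_mem ht

/-! ## Comparison with an arbitrary schedule -/

/-- Locations and completion times of a valid schedule that respects the budget. -/
structure Feasible (d : Input) (loc C : ℕ → ℕ) : Prop where
  loc_lt : ∀ j, loc j < 2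
  sequential : ∀ i < d.jobs.length, ∀ j < d.jobs.length, loc i = 0 → loc j = 0 → i ≠ j →
    C i + duration d j 0 ≤ C j ∨ C j + duration d i 0 ≤ C i
  precedence : ∀ e ∈ d.edges, C e.1 + (if loc e.1 = loc e.2.1 then 0 else e.2.2) +
    duration d e.2.1 (loc e.2.1) ≤ C e.2.1
  loc_eq_one : ∀ j, loc j = 1 → ¬ (j = d.source ∨ j = d.sink)
  cost_le : ∑ j ∈ Finset.range d.jobs.length, (if loc j = 1 then duration d j 1 else 0) ≤ d.budget

theorem Reach.feasible {d : Input} (hd : d.WellFormed) {s : Partial} (h : Reach d s)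
    (hs : s.length = d.jobs.length) :
    -- The location `2` of a job that is not scheduled is replaced by `0`, as locations have to be
    -- below `2` also for numbers that are not jobs.
    Feasible d (fun j => if (lookup s j).1 = 1 then 1 else 0) (fun j => (lookup s j).2) := by
  have hloc : ∀ j < d.jobs.length, (if (lookup s j).1 = 1 then 1 else 0) = (lookup s j).1 := by
    intro j hj
    have := (h.done_iff j).1 (h.done_of_length hd hs hj)
    split_ifs <;> omega
  constructor
  · intro j
    split_ifs <;> omega
  · intro i hi j hj hi0 hj0 hij
    rw [hloc i hi] at hi0
    rw [hloc j hj] at hj0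
    exact h.sequential hi0 hj0 hij
  · intro e he
    obtain ⟨h1, h2⟩ := hd.edges_lt e he
    simp only [hloc _ h1, hloc _ h2]
    exact (h.precedence hd he (h.done_of_length hd hs h2)).2
  · intro j hj
    have : (lookup s j).1 = 1 := by
      by_contra h
      simp [h] at hj
    have := h.location_eq_one this
    tauto
  · have h1 := h.partialCost_le
    rw [h.partialCost_eq] at h1
    simpa using h1

section Compare

variable {d : Input} {loc C : ℕ → ℕ}

/-! ### The order in which a given schedule is followed -/

namespace Feasible

theorem duration_le (hd : d.WellFormed) (h : Feasible d loc C) {j : ℕ} (hj : j < d.jobs.length) :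
    duration d j (loc j) ≤ C j := by
  by_cases hj' : j = d.source
  · have h1 := h.loc_lt j
    have h2 := h.loc_eq_one j
    rw [show loc j = 0 by by_contra; exact h2 (by omega) (.inl hj'), hj', hd.duration_source]
    exact Nat.zero_le _
  · obtain ⟨e, he, rfl⟩ := hd.exists_pred j hj hj'
    have := h.precedence e he
    omega

/-- Start plus completion time; refined by a rank, this orders the jobs as they are scheduled. -/
def weight (d : Input) (loc C : ℕ → ℕ) (j : ℕ) : ℕ := C j + (C j - duration d j (loc j))

/-- Completion times do not decrease along edges. A job of maximal rank among those completed no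
earlier than `j` has no successor, so it is the sink. -/
theorem le_sink (hd : d.WellFormed) (h : Feasible d loc C) {j : ℕ} (hj : j < d.jobs.length) :
    C j ≤ C d.sink := by
  obtain ⟨r, hr⟩ := hd.acyclic
  obtain ⟨i, hi, hmax⟩ := Finset.exists_max_image ((Finset.range d.jobs.length).filter
    fun i => C j ≤ C i) r ⟨j, by simp [hj]⟩
  simp only [Finset.mem_filter, Finset.mem_range] at hi hmax
  by_cases hi' : i = d.sink
  · exact hi' ▸ hi.2
  · obtain ⟨e, he, rfl⟩ := hd.exists_succ i hi.1 hi'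
    have h1 := h.precedence e he
    have h2 := hmax e.2.1 ⟨(hd.edges_lt e he).2, by omega⟩
    have h3 := hr e he
    omega

theorem weight_le (hd : d.WellFormed) (h : Feasible d loc C) {e : ℕ × ℕ × ℕ} (he : e ∈ d.edges) :
    weight d loc C e.1 ≤ weight d loc C e.2.1 := by
  have h1 := h.precedence e he
  have h2 := h.duration_le hd (hd.edges_lt e he).1
  unfold weight
  omega

/-- If instead `j` ends before `i` starts, then the weight of `j` is at most that of `i`. With the
hypothesis, all four start and completion times coincide, and the desired order holds too. Ordering
by start or by completion alone would not settle ties with jobs of duration zero. -/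
theorem add_duration_le (hd : d.WellFormed) (h : Feasible d loc C) {i j : ℕ}
    (hi : i < d.jobs.length) (hj : j < d.jobs.length) (hij : i ≠ j) (hi0 : loc i = 0)
    (hj0 : loc j = 0) (hw : weight d loc C i ≤ weight d loc C j) :
    C i + duration d j 0 ≤ C j := by
  have h1 := h.sequential i hi j hj hi0 hj0 hij
  have h2 := h.duration_le hd hi
  have h3 := h.duration_le hd hj
  unfold weight at hw
  rw [hi0] at h2 hw
  rw [hj0] at h3 hw
  omega

end Feasible

/-- The partial schedule follows the given schedule, up to a factor `F`. -/
structure Tracks (d : Input) (loc C r : ℕ → ℕ) (F : ℚ) (s : Partial) : Prop where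
  reach : Reach d s
  closed : ∀ i j, Done s j → i < d.jobs.length → ¬ Done s i →
    toLex (Feasible.weight d loc C j, r j) ≤ toLex (Feasible.weight d loc C i, r i)
  ready : ∃ ρ : ℕ, (ready s : ℚ) ≤ F * ρ ∧ ρ ≤ C d.sink ∧
    ∀ x < d.jobs.length, ¬ Done s x → loc x = 0 → ρ + duration d x 0 ≤ C x
  active : ∀ i, Done s i → IsActive d s i →
    (lookup s i).1 = loc i ∧ ((lookup s i).2 : ℚ) ≤ F * C i
  cost : partialCost d s ≤ ∑ j ∈ Finset.range d.jobs.length,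
    if Done s j ∧ loc j = 1 then duration d j 1 else 0

/-! ### What the key determines -/

section Key

theorem ready_eq_of_key_eq {s t : Partial} (h : key d t = key d s) : ready t = ready s :=
  (List.cons.inj h).1

theorem jobCode_eq_of_key_eq {s t : Partial} (h : key d t = key d s) {j : ℕ}
    (hj : j < d.jobs.length) : jobCode d t j = jobCode d s j :=
  List.map_inj_left.1 (List.cons.inj h).2 j (List.mem_range.2 hj)

theorem done_iff_jobCode (s : Partial) (j : ℕ) : Done s j ↔ jobCode d s j ≠ 0 := by
  unfold jobCode
  split_ifs with h1 h2 <;> simp [h1]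

theorem done_iff_of_key_eq (hd : d.WellFormed) {s t : Partial} (hs : Reach d s) (ht : Reach d t)
    (h : key d t = key d s) (j : ℕ) : Done t j ↔ Done s j := by
  by_cases hj : j < d.jobs.length
  · rw [done_iff_jobCode (d := d), done_iff_jobCode (d := d), jobCode_eq_of_key_eq h hj]
  · exact iff_of_false (fun h' => hj (ht.lt_of_done hd h')) fun h' => hj (hs.lt_of_done hd h')

theorem isActive_congr {s t : Partial} (h : ∀ j, Done t j ↔ Done s j) (j : ℕ) :
    IsActive d t j ↔ IsActive d s j := by
  simp only [IsActive, h]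

/-- Locations of done jobs are below `2`, so the parity of the code gives the location and the rest
gives the time. -/
theorem lookup_eq_of_jobCode_eq {s t : Partial} (hs : Reach d s) (ht : Reach d t) {j : ℕ}
    (h : jobCode d t j = jobCode d s j) (hdone : Done s j) (hdone' : Done t j)
    (hact : IsActive d s j) (hact' : IsActive d t j) : lookup t j = lookup s j := by
  rw [jobCode, jobCode, if_pos hdone, if_pos hdone', if_pos hact, if_pos hact'] at h
  have h1 := (hs.done_iff j).1 hdone
  have h2 := (ht.done_iff j).1 hdone'
  ext <;> omega

end Key

/-- This justifies pruning. All clauses are phrased through the key, except the cost, which may only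
drop. For this reason the cost is compared with the locations of the reference schedule, since those
of inactive jobs are forgotten, and `ρ` is a bare number that is not attached to a job. -/
theorem Tracks.congr (hd : d.WellFormed) {r : ℕ → ℕ} {F : ℚ} {s t : Partial}
    (h : Tracks d loc C r F s) (ht : Reach d t) (hk : key d t = key d s)
    (hc : partialCost d t ≤ partialCost d s) : Tracks d loc C r F t := by
  have hdone := done_iff_of_key_eq hd h.reach ht hk
  have hact := isActive_congr (d := d) hdone
  refine ⟨ht, ?_, ?_, ?_, ?_⟩
  · simpa only [hdone] using h.closed
  · simpa only [hdone, ready_eq_of_key_eq hk] using h.ready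
  · intro i hi hi'
    rw [lookup_eq_of_jobCode_eq h.reach ht (jobCode_eq_of_key_eq hk (ht.lt_of_done hd hi))
      ((hdone i).1 hi) hi ((hact i).1 hi') hi']
    exact h.active i ((hdone i).1 hi) ((hact i).1 hi')
  · simpa only [hdone] using hc.trans h.cost

theorem Tracks.base (hd : d.WellFormed) (h : Feasible d loc C) {r : ℕ → ℕ}
    (hr : ∀ e ∈ d.edges, r e.1 < r e.2.1) : Tracks d loc C r 1 [(d.source, 0, 0)] := by
  have hlt : ∀ e ∈ d.edges, toLex (Feasible.weight d loc C e.1, r e.1) <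
      toLex (Feasible.weight d loc C e.2.1, r e.2.1) := fun e he => by
    rw [Prod.Lex.toLex_lt_toLex]
    exact (h.weight_le hd he).lt_or_eq.imp_right fun h' => ⟨h', hr e he⟩
  have hdone : ∀ j, Done [(d.source, 0, 0)] j → j = d.source := fun j hj => by
    by_contra h'
    simp [Done, lookup, Ne.symm h'] at hj
  refine ⟨.base, ?_, ⟨0, by simp [ServerCloud.ready], Nat.zero_le _, ?_⟩, ?_, by simp [partialCost]⟩
  · intro i j hj hi _
    obtain rfl := hdone j hj
    -- The least job in the order is the source: any other job has a predecessor, which is strictly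
    -- smaller.
    obtain ⟨x, hx, hmin⟩ := Finset.exists_min_image (Finset.range d.jobs.length)
      (fun j => toLex (Feasible.weight d loc C j, r j)) ⟨i, by simp [hi]⟩
    simp only [Finset.mem_range] at hx hmin
    obtain rfl : x = d.source := by
      by_contra hx'
      obtain ⟨e, he, rfl⟩ := hd.exists_pred x hx hx'
      exact absurd (hlt e he) (not_lt.2 (hmin e.1 (hd.edges_lt e he).1))
    exact hmin i hi
  · intro x hx _ hx0
    simpa [hx0] using h.duration_le hd hx
  · intro i hi _
    obtain rfl := hdone i hi
    have h1 := h.loc_lt d.source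
    have h2 := h.loc_eq_one d.source
    have h3 : loc d.source = 0 := by
      by_contra
      exact h2 (by omega) (.inl rfl)
    simp [lookup, h3]

theorem start_cases (d : Input) (s : Partial) (x l : ℕ) : start d s x l = 0 ∨
    (l = 0 ∧ start d s x l = ready s) ∨ ∃ e ∈ d.edges, e.2.1 = x ∧
      start d s x l = (lookup s e.1).2 + (if (lookup s e.1).1 = l then 0 else e.2.2) := by
  unfold start
  rcases max_choice (if l = 0 then ready s else 0) ((d.edges.map fun e =>
    if e.2.1 = x then (lookup s e.1).2 + (if (lookup s e.1).1 = l then 0 else e.2.2)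
      else 0).foldr max 0) with h | h <;> rw [h]
  · split_ifs <;> tauto
  · rcases foldr_max_cases (d.edges.map fun e =>
      if e.2.1 = x then (lookup s e.1).2 + (if (lookup s e.1).1 = l then 0 else e.2.2)
        else 0) with h | h
    · exact .inl h
    · obtain ⟨e, he, h⟩ := List.mem_map.1 h
      rw [← h]
      by_cases hx : e.2.1 = x
      · exact .inr (.inr ⟨e, he, hx, by simp [hx]⟩)
      · simp [hx]

theorem ready_le_start (d : Input) (s : Partial) (x : ℕ) : ready s ≤ start d s x 0 :=
  le_max_left _ _

/-- The start is zero, the idle time of the server, or determined by one predecessor. That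
predecessor is active because `x` is undone, so its location agrees with the reference and the same
delay is paid. In each case the start is at most `F * z` plus a waiting time that the reference also
pays; as `1 ≤ F`, delays and durations can be absorbed into the factor. -/
theorem Tracks.start_add_le (hd : d.WellFormed) (h : Feasible d loc C) {r : ℕ → ℕ} {F : ℚ}
    (hF : 1 ≤ F) {s : Partial} (hs : Tracks d loc C r F s) {x : ℕ} (hx : x < d.jobs.length)
    (hx' : ¬ Done s x) (hpred : ∀ e ∈ d.edges, e.2.1 = x → Done s e.1) :
    ((start d s x (loc x) + duration d x (loc x) : ℕ) : ℚ) ≤ F * C x := by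
  have main : ∀ y : ℕ, ∀ p : ℕ, ∀ z : ℕ, (y : ℚ) ≤ F * z → z + p ≤ C x →
      ((y + p : ℕ) : ℚ) ≤ F * C x := by
    intro y p z h1 h2
    have h2' : (z : ℚ) + p ≤ C x := by exact_mod_cast h2
    push_cast
    nlinarith [(Nat.cast_nonneg p : (0 : ℚ) ≤ p)]
  rcases start_cases d s x (loc x) with h0 | ⟨h0, h1⟩ | ⟨e, he, hex, h1⟩
  · rw [h0]
    exact main 0 _ 0 (by simp) (by simpa using h.duration_le hd hx)
  · obtain ⟨ρ, h2, -, h3⟩ := hs.ready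
    rw [h1]
    refine main _ _ ρ h2 ?_
    rw [h0]
    exact h3 x hx hx' h0
  · have hact : IsActive d s e.1 := ⟨e, he, rfl, hex ▸ hx'⟩
    obtain ⟨h2, h3⟩ := hs.active e.1 (hpred e he hex) hact
    have h4 := h.precedence e he
    rw [hex] at h4
    rw [h1, h2, add_assoc]
    refine main _ _ (C e.1) h3 (by omega)

theorem Tracks.step (hd : d.WellFormed) (h : Feasible d loc C) {r : ℕ → ℕ}
    (hr : ∀ e ∈ d.edges, r e.1 < r e.2.1) {F : ℚ} (hF : 1 ≤ F) {s : Partial}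
    (hs : Tracks d loc C r F s) (hlen : s.length < d.jobs.length) :
    ∃ x < d.jobs.length, Avail d s x (loc x) ∧
      Tracks d loc C r (F * (1 + 1 / d.accuracy)) (extend d s x (loc x)) := by
  obtain ⟨x₀, hx₀, hx₀'⟩ := hs.reach.exists_not_done hd hlen
  -- The next job is the least undone one in the order of the reference schedule. Edges strictly
  -- increase this order, so all predecessors of that job are done.
  obtain ⟨x, hx, hmin⟩ := Finset.exists_min_image
    ((Finset.range d.jobs.length).filter fun j => ¬ Done s j)
    (fun j => toLex (Feasible.weight d loc C j, r j)) ⟨x₀, by simp [hx₀, hx₀']⟩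
  simp only [Finset.mem_filter, Finset.mem_range] at hx hmin
  obtain ⟨hx, hx'⟩ := hx
  have hpred : ∀ e ∈ d.edges, e.2.1 = x → Done s e.1 := by
    rintro e he rfl
    by_contra hdone
    refine absurd (hmin e.1 ⟨(hd.edges_lt e he).1, hdone⟩) (not_le.2 ?_)
    rw [Prod.Lex.toLex_lt_toLex]
    exact (h.weight_le hd he).lt_or_eq.imp_right fun h' => ⟨h', hr e he⟩
  have hl := h.loc_lt x
  have hdone : ∀ i, Done (extend d s x (loc x)) i ↔ i = x ∨ Done s i :=
    fun i => Reach.done_extend hl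
  have hcost : partialCost d (extend d s x (loc x)) ≤ ∑ j ∈ Finset.range d.jobs.length,
      if Done (extend d s x (loc x)) j ∧ loc j = 1 then duration d j 1 else 0 := by
    have h1 : ∀ j, (if Done (extend d s x (loc x)) j ∧ loc j = 1 then duration d j 1 else 0) =
        (if x = j then (if loc x = 1 then (d.jobs.getD x (0, 0)).2 else 0) else 0) +
          if Done s j ∧ loc j = 1 then duration d j 1 else 0 := by
      intro j
      simp only [hdone]
      by_cases hj : x = j
      · subst hj
        simp only [hx', true_or, true_and, false_and, if_true, if_false]
        rfl
      · simp [hj, Ne.symm hj]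
    rw [Finset.sum_congr rfl fun j _ => h1 j, Finset.sum_add_distrib, Finset.sum_ite_eq,
      if_pos (Finset.mem_range.2 hx), partialCost_extend]
    exact Nat.add_le_add_left hs.cost _
  -- The new cost is at most what the reference pays for the done jobs, hence at most its total
  -- cost, hence within the budget.
  have hav : Avail d s x (loc x) := by
    refine ⟨hx', hpred, ?_, hcost.trans (le_trans (Finset.sum_le_sum fun j _ => ?_) h.cost_le)⟩
    · by_cases h0 : loc x = 0
      · exact .inl h0
      · exact .inr (h.loc_eq_one x (by omega))
    · split_ifs with h1 h2 <;> first | exact le_rfl | exact Nat.zero_le _ | exact absurd h1.2 h2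
  refine ⟨x, hx, hav, ?_⟩
  have hM : (0 : ℚ) < d.accuracy := by exact_mod_cast hd.accuracy_pos
  have hF' : F ≤ F * (1 + 1 / d.accuracy) :=
    le_mul_of_one_le_right (by linarith) (by
      have : (0 : ℚ) ≤ 1 / d.accuracy := by positivity
      linarith)
  have hnew : (roundUp d.accuracy (start d s x (loc x) + duration d x (loc x)) : ℚ) ≤
      F * (1 + 1 / d.accuracy) * C x := by
    have h1 := hs.start_add_le hd h hF hx hx' hpred
    have h2 := mul_roundUp_le hd.accuracy_pos (start d s x (loc x) + duration d x (loc x))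
    generalize start d s x (loc x) + duration d x (loc x) = t at *
    generalize roundUp d.accuracy t = u at *
    have h2' : (d.accuracy : ℚ) * u ≤ (d.accuracy + 1) * t := by exact_mod_cast h2
    have h3 : (u : ℚ) ≤ (1 + 1 / d.accuracy) * t := by
      rw [← mul_le_mul_iff_right₀ hM]
      calc (d.accuracy : ℚ) * u ≤ (d.accuracy + 1) * t := h2'
        _ = d.accuracy * ((1 + 1 / d.accuracy) * t) := by field_simp
    calc (u : ℚ) ≤ (1 + 1 / d.accuracy) * t := h3
      _ ≤ (1 + 1 / d.accuracy) * (F * C x) := by gcongr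
      _ = _ := by ring
  refine ⟨.step hs.reach hx hl hav, ?_, ?_, ?_, hcost⟩
  · intro i j hj hi hi'
    rw [hdone, not_or] at hi'
    rcases (hdone j).1 hj with rfl | hj
    · exact hmin i ⟨hi, hi'.2⟩
    · exact hs.closed i j hj hi hi'.2
  · obtain ⟨ρ, h1, h2, h3⟩ := hs.ready
    rw [ready_extend]
    by_cases h0 : loc x = 0
    -- All server jobs that remain undone come later in the order, so in the reference they start no
    -- earlier than `C x`.
    · refine ⟨C x, ?_, h.le_sink hd hx, ?_⟩
      · rw [if_pos h0, max_eq_left]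
        · exact hnew
        · refine le_trans ?_ (le_roundUp _ _)
          rw [h0]
          exact (ready_le_start d s x).trans (Nat.le_add_right _ _)
      · intro y hy hy' hy0
        rw [hdone, not_or] at hy'
        refine h.add_duration_le hd hx hy (Ne.symm hy'.1) h0 hy0 ?_
        have := hmin y ⟨hy, hy'.2⟩
        rw [Prod.Lex.toLex_le_toLex] at this
        rcases this with h | h
        · exact h.le
        · exact h.1.le
    · refine ⟨ρ, ?_, h2, ?_⟩
      · rw [if_neg h0, Nat.zero_max]
        exact h1.trans (mul_le_mul_of_nonneg_right hF' (Nat.cast_nonneg _))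
      · intro y hy hy' hy0
        rw [hdone, not_or] at hy'
        exact h3 y hy hy'.2 hy0
  · intro i hi hi'
    by_cases hix : x = i
    · subst hix
      rw [lookup_extend, if_pos rfl]
      exact ⟨rfl, hnew⟩
    · rw [lookup_extend, if_neg hix]
      have hact : IsActive d s i := by
        obtain ⟨e, he, h1, h2⟩ := hi'
        rw [hdone, not_or] at h2
        exact ⟨e, he, h1, h2.2⟩
      obtain ⟨h1, h2⟩ := hs.active i (((hdone i).1 hi).resolve_left (Ne.symm hix)) hact
      exact ⟨h1, h2.trans (mul_le_mul_of_nonneg_right hF' (Nat.cast_nonneg _))⟩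

theorem exists_tracks (hd : d.WellFormed) (h : Feasible d loc C) {r : ℕ → ℕ}
    (hr : ∀ e ∈ d.edges, r e.1 < r e.2.1) {m : ℕ} (hm : m < d.jobs.length) :
    ∃ s ∈ layer d m, Tracks d loc C r ((1 + 1 / d.accuracy) ^ m) s := by
  induction m with
  | zero => exact ⟨_, List.mem_singleton_self _, by simpa using Tracks.base hd h hr⟩
  | succ m ih =>
    obtain ⟨s, hs, ht⟩ := ih (by omega)
    have hF : (1 : ℚ) ≤ (1 + 1 / d.accuracy) ^ m :=
      one_le_pow₀ (le_add_of_nonneg_right (by positivity))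
    obtain ⟨x, hx, hav, ht'⟩ := ht.step hd h hr hF (by rw [(reach_of_mem_layer hs).2]; omega)
    obtain ⟨t, h1, h2, h3⟩ := exists_mem_layer_succ hs hx (h.loc_lt x) hav
    exact ⟨t, h1, (pow_succ (1 + 1 / (d.accuracy : ℚ)) m).symm ▸
      ht'.congr hd (reach_of_mem_layer h1).1 h2 h3⟩

/-- The partial schedule computed by the algorithm. -/
def solution (d : Input) : Partial := best (layer d (d.jobs.length - 1))

theorem solution_spec (hd : d.WellFormed) : Reach d (solution d) ∧
    (solution d).length = d.jobs.length ∧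
      ∀ t ∈ layer d (d.jobs.length - 1), ready (solution d) ≤ ready t := by
  have h0 := hd.source_lt
  obtain ⟨h1, h2⟩ := best_spec (layer_ne_nil hd (m := d.jobs.length - 1) (by omega))
    fun s hs h => by
    have := (reach_of_mem_layer hs).2
    simp [h] at this
  obtain ⟨h3, h4⟩ := reach_of_mem_layer h1
  exact ⟨h3, h4.trans (by omega), h2⟩

/-- The sink has no successor, so its completion time is not part of the key. It is recovered from
the idle time of the server, where the sink must be placed. -/
theorem solution_le (hd : d.WellFormed) (h : Feasible d loc C) :
    ((lookup (solution d) d.sink).2 : ℚ) ≤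
      (1 + 1 / d.accuracy) ^ (d.jobs.length - 1) * C d.sink := by
  have h0 := hd.source_lt
  obtain ⟨r, hr⟩ := hd.acyclic
  obtain ⟨s, hs, ht⟩ := exists_tracks hd h hr (m := d.jobs.length - 1) (by omega)
  obtain ⟨h1, h2, h3⟩ := solution_spec hd
  have h4 : (lookup (solution d) d.sink).1 = 0 := by
    have := (h1.done_iff d.sink).1 (h1.done_of_length hd h2 hd.sink_lt)
    by_contra h'
    exact (h1.location_eq_one (j := d.sink) (by omega)).2 rfl
  obtain ⟨ρ, h5, h6, -⟩ := ht.ready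
  calc ((lookup (solution d) d.sink).2 : ℚ) ≤ ready s := by
        exact_mod_cast (h1.le_ready h4).trans (h3 s hs)
    _ ≤ _ := h5
    _ ≤ _ := by gcongr

end Compare

/-! ## The number of partial schedules that are kept -/

/-- A set with at most `k + 1` elements arises from one with at most `k` by inserting an optional
element, which leaves `X.card + 1` choices. -/
theorem card_powerset_filter_card_le {α : Type*} [DecidableEq α] (X : Finset α) (k : ℕ) :
    (X.powerset.filter fun S => S.card ≤ k).card ≤ (X.card + 1) ^ k := by
  induction k with
  | zero =>
    rw [pow_zero, Finset.card_le_one]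
    intro a ha b hb
    simp only [Finset.mem_filter, Nat.le_zero, Finset.card_eq_zero] at ha hb
    rw [ha.2, hb.2]
  | succ k ih =>
    have hsub : (X.powerset.filter fun S => S.card ≤ k + 1) ⊆
        ((X.powerset.filter fun S => S.card ≤ k) ×ˢ Finset.insertNone X).image
          fun y => y.2.elim y.1 fun x => insert x y.1 := by
      intro S hS
      simp only [Finset.mem_filter, Finset.mem_powerset] at hS
      obtain ⟨hSX, hSk⟩ := hS
      rw [Finset.mem_image]
      rcases S.eq_empty_or_nonempty with rfl | ⟨x, hx⟩
      · exact ⟨(∅, none), by simp, rfl⟩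
      · refine ⟨(S.erase x, some x), ?_, Finset.insert_erase hx⟩
        simp only [Finset.mem_product, Finset.mem_filter, Finset.mem_powerset,
          Finset.some_mem_insertNone]
        refine ⟨⟨(Finset.erase_subset _ _).trans hSX, ?_⟩, hSX hx⟩
        rw [Finset.card_erase_of_mem hx]
        omega
    calc _ ≤ _ := (Finset.card_le_card hsub).trans Finset.card_image_le
      _ ≤ _ := by
        rw [Finset.card_product, Finset.card_insertNone, pow_succ]
        exact Nat.mul_le_mul_right _ ih

/-! ### The size and shape of completion times -/

section Values

theorem lookup_mem (s : Partial) (j : ℕ) : lookup s j = (2, 0) ∨ (j, lookup s j) ∈ s := by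
  induction s with
  | nil => exact .inl rfl
  | cons e s ih =>
    rw [lookup_cons]
    split_ifs with h
    · exact .inr (by simp [← h])
    · exact ih.imp_right fun h => by simp [h]

theorem ready_mem (s : Partial) : ready s = 0 ∨ ∃ e ∈ s, ready s = e.2.2 := by
  rcases foldr_max_cases (s.map fun e : ℕ × ℕ × ℕ => if e.2.1 = 0 then e.2.2 else 0) with h | h
  · exact .inl h
  · obtain ⟨e, he, h⟩ := List.mem_map.1 h
    change _ = ready s at h
    split_ifs at h
    · exact .inr ⟨e, he, h.symm⟩
    · exact .inl h.symm

/-- Three bits per job suffice. If all previous times are below `B ≥ 2 ^ V`, a new start is below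
`2B`, since at most one delay is added; the unrounded completion is below `3B`, and rounding at most
doubles it, giving less than `8B`. -/
theorem Reach.entry {d : Input} {V : ℕ} (hM : 0 < d.accuracy) (hsrc : d.source < d.jobs.length)
    (hdur : ∀ j l, duration d j l < 2 ^ V) (hdel : ∀ e ∈ d.edges, e.2.2 < 2 ^ V) {s : Partial}
    (h : Reach d s) : ∀ e ∈ s, e.1 < d.jobs.length ∧ e.2.1 < 2 ∧ e.2.2 < 2 ^ (V + 3 * s.length) ∧
      ∃ a ≤ 2 * d.accuracy, ∃ i ≤ V + 3 * s.length, e.2.2 = a * 2 ^ i := by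
  induction h with
  | base =>
    intro e he
    obtain rfl := List.mem_singleton.1 he
    exact ⟨hsrc, by simp, by simp, 0, by simp, 0, by simp, by simp⟩
  | @step s j l hs hj hl ha ih =>
    have e1 : V + 3 * (extend d s j l).length = V + 3 * s.length + 3 := by
      simp only [extend, List.length_cons]; ring
    have hp : 0 < 2 ^ (V + 3 * s.length) := by positivity
    have hV : 2 ^ V ≤ 2 ^ (V + 3 * s.length) := Nat.pow_le_pow_right (by norm_num) (by omega)
    have hstart : start d s j l < 2 * 2 ^ (V + 3 * s.length) := by
      rcases start_cases d s j l with h | ⟨-, h⟩ | ⟨e, he, -, h⟩ <;> rw [h]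
      · omega
      · rcases ready_mem s with h | ⟨e, he, h⟩
        · omega
        · have := (ih e he).2.2.1
          omega
      · have h1 : (lookup s e.1).2 < 2 ^ (V + 3 * s.length) := by
          rcases lookup_mem s e.1 with h | h
          · rw [h]; exact hp
          · exact (ih _ h).2.2.1
        have h2 := hdel e he
        split_ifs <;> omega
    have ht := hdur j l
    rw [e1]
    intro e he
    rcases List.mem_cons.1 he with rfl | he
    · refine ⟨hj, hl, ?_, ?_⟩
      · have h1 := mul_roundUp_le hM (start d s j l + duration d j l)
        dsimp only
        generalize htt : start d s j l + duration d j l = t at *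
        have h2 : roundUp d.accuracy t ≤ 2 * t := by
          by_contra! h3
          nlinarith
        rw [pow_add]
        omega
      · obtain ⟨a, ha, i, hi, h⟩ := roundUp_eq hM (start d s j l + duration d j l)
        refine ⟨a, ha, i, hi.trans ?_, h⟩
        rw [Nat.size_le, pow_add]
        omega
    · obtain ⟨h1, h2, h3, a, ha, i, hi, h4⟩ := ih e he
      refine ⟨h1, h2, h3.trans_le (Nat.pow_le_pow_right (by norm_num) (by omega)), a, ha, i,
        by omega, h4⟩

end Values

/-! ### Counting keys by labelled cuts -/

section Count

variable {d : Input}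

/-- The edges from scheduled to unscheduled jobs. -/
def cutEdges (d : Input) (s : Partial) : Finset (ℕ × ℕ × ℕ) :=
  d.edges.toFinset.filter fun e => Done s e.1 ∧ ¬ Done s e.2.1

/-- These edges, labelled with what has to be remembered of their tails. -/
def labelledCut (d : Input) (s : Partial) : Finset ((ℕ × ℕ × ℕ) × ℕ) :=
  (cutEdges d s).image fun e => (e, jobCode d s e.1)

theorem mem_cutEdges {s : Partial} {e : ℕ × ℕ × ℕ} :
    e ∈ cutEdges d s ↔ e ∈ d.edges ∧ Done s e.1 ∧ ¬ Done s e.2.1 := by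
  simp [cutEdges]

theorem cutEdges_eq (s : Partial) : cutEdges d s = (labelledCut d s).image Prod.fst := by
  rw [labelledCut, Finset.image_image]
  exact Finset.image_id.symm

/-- The cut determines the done jobs. Let `j` be done in `t` but not in `s`, of least rank. A
predecessor of `j` is done in `t`, hence in `s`, so the edge between them lies in the cut of `s` but
not in that of `t`. -/
theorem done_of_cutEdges_eq (hd : d.WellFormed) {s t : Partial} (hs : Reach d s) (ht : Reach d t)
    (h : cutEdges d s = cutEdges d t) {j : ℕ} (hj : Done t j) : Done s j := by
  obtain ⟨r, hr⟩ := hd.acyclic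
  induction hn : r j using Nat.strong_induction_on generalizing j with
  | _ n ih =>
    by_contra hj'
    have hjs : j ≠ d.source := by
      rintro rfl
      exact hj' hs.done_source
    obtain ⟨e, he, rfl⟩ := hd.exists_pred j (ht.lt_of_done hd hj) hjs
    have h1 := ih _ (hn ▸ hr e he) (ht.precedence hd he hj).1 rfl
    have h2 : e ∈ cutEdges d t := h ▸ mem_cutEdges.2 ⟨he, h1, hj'⟩
    exact (mem_cutEdges.1 h2).2.2 hj

/-- Every active done job is the tail of a cut edge, whose label is its code. The other codes depend
only on which jobs are done. -/
theorem key_eq_of_labelledCut_eq (hd : d.WellFormed) {s t : Partial} (hs : Reach d s)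
    (ht : Reach d t) (hr : ready s = ready t) (h : labelledCut d s = labelledCut d t) :
    key d s = key d t := by
  have hcut : cutEdges d s = cutEdges d t := by rw [cutEdges_eq, cutEdges_eq, h]
  have hdone : ∀ j, Done s j ↔ Done t j := fun j =>
    ⟨done_of_cutEdges_eq hd ht hs hcut.symm, done_of_cutEdges_eq hd hs ht hcut⟩
  unfold key
  rw [hr]
  congr 1
  refine List.map_congr_left fun j _ => ?_
  by_cases h1 : Done s j ∧ IsActive d s j
  · obtain ⟨h1, e, he, rfl, h2⟩ := h1
    have h3 : (e, jobCode d s e.1) ∈ labelledCut d s :=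
      Finset.mem_image_of_mem _ (mem_cutEdges.2 ⟨he, h1, h2⟩)
    rw [h] at h3
    obtain ⟨e', -, h4⟩ := Finset.mem_image.1 h3
    obtain ⟨rfl, h4⟩ := Prod.mk.inj h4
    exact h4.symm
  · have h2 := isActive_congr (d := d) hdone j
    simp only [jobCode, hdone, h2] at h1 ⊢
    split_ifs <;> tauto

/-- The possible completion times. -/
def grid (d : Input) (B : ℕ) : Finset ℕ :=
  (Finset.range (2 * d.accuracy + 1) ×ˢ Finset.range (B + 1)).image fun x => x.1 * 2 ^ x.2

theorem card_grid_le (d : Input) (B : ℕ) : (grid d B).card ≤ (2 * d.accuracy + 1) * (B + 1) :=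
  Finset.card_image_le.trans (by simp)

theorem Reach.length_le (hd : d.WellFormed) {s : Partial} (h : Reach d s) :
    s.length ≤ d.jobs.length := by
  rw [← h.card_done hd]
  exact (Finset.card_filter_le _ _).trans (by simp)

theorem Reach.mem_grid (hd : d.WellFormed) {V : ℕ} (hdur : ∀ j l, duration d j l < 2 ^ V)
    (hdel : ∀ e ∈ d.edges, e.2.2 < 2 ^ V) {s : Partial} (h : Reach d s) {e : ℕ × ℕ × ℕ}
    (he : e ∈ s) : e.2.2 ∈ grid d (V + 3 * d.jobs.length) := by
  obtain ⟨-, -, -, a, ha, i, hi, h4⟩ := h.entry hd.accuracy_pos hd.source_lt hdur hdel e he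
  have := h.length_le hd
  exact Finset.mem_image.2 ⟨(a, i), by simp; omega, h4.symm⟩

/-- A member of a layer is determined by its idle time, one of `g` values, and a set of at most `k`
labelled edges. A label consists of a grid time and one of two locations, which gives `2 * g` labels
per edge. -/
theorem length_layer_le (hd : d.WellFormed) {V k : ℕ} (hdur : ∀ j l, duration d j l < 2 ^ V)
    (hdel : ∀ e ∈ d.edges, e.2.2 < 2 ^ V) (hcut : ∀ s, Reach d s → (cutEdges d s).card ≤ k)
    (m : ℕ) {g : ℕ} (hg : (grid d (V + 3 * d.jobs.length)).card ≤ g) :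
    (layer d m).length ≤ g * (d.edges.length * (2 * g) + 1) ^ k := by
  set G := grid d (V + 3 * d.jobs.length) with hG
  have h0 : 0 ∈ G := Finset.mem_image.2 ⟨(0, 0), by simp, by simp⟩
  set K := (G ×ˢ Finset.range 2).image fun x => 2 + 2 * x.1 + x.2 with hK
  set X := d.edges.toFinset ×ˢ K with hX
  have hKc : K.card ≤ 2 * g := by
    refine Finset.card_image_le.trans ?_
    rw [Finset.card_product, Finset.card_range]
    omega
  have hXc : X.card ≤ d.edges.length * (2 * g) := by
    rw [hX, Finset.card_product]
    exact Nat.mul_le_mul (List.toFinset_card_le _) hKc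
  have hnd := nodup_map_key_layer d m
  have hnd' : (layer d m).Nodup := hnd.of_map _
  rw [← List.toFinset_card_of_nodup hnd']
  refine (Finset.card_le_card_of_injOn
    (t := G ×ˢ X.powerset.filter fun S => S.card ≤ k) (fun s => (ready s, labelledCut d s))
    ?_ ?_).trans ?_
  · intro s hs
    have hs : Reach d s := (reach_of_mem_layer (by simpa using hs)).1
    simp only [Finset.coe_product, Set.mem_prod, Finset.mem_coe, Finset.mem_filter,
      Finset.mem_powerset]
    refine ⟨?_, ?_, Finset.card_image_le.trans (hcut s hs)⟩
    · rcases ready_mem s with h | ⟨e, he, h⟩ <;> rw [h]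
      · exact h0
      · exact hs.mem_grid hd hdur hdel he
    · intro x hx
      obtain ⟨e, he, rfl⟩ := Finset.mem_image.1 hx
      obtain ⟨h1, h2, h3⟩ := mem_cutEdges.1 he
      refine Finset.mem_product.2 ⟨List.mem_toFinset.2 h1, Finset.mem_image.2
        ⟨((lookup s e.1).2, (lookup s e.1).1), ?_, ?_⟩⟩
      · have h4 := (hs.done_iff _).1 h2
        rcases lookup_mem s e.1 with h | h
        · exact absurd (by rw [h]) h2
        · exact Finset.mem_product.2 ⟨hs.mem_grid hd hdur hdel h, Finset.mem_range.2 h4⟩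
      · exact (by rw [jobCode, if_pos h2, if_pos ⟨e, h1, rfl, h3⟩])
  · intro s hs t ht hst
    rw [Finset.mem_coe, List.mem_toFinset] at hs ht
    obtain ⟨h1, h2⟩ := Prod.mk.inj hst
    exact List.inj_on_of_nodup_map hnd hs ht (key_eq_of_labelledCut_eq hd
      (reach_of_mem_layer hs).1 (reach_of_mem_layer ht).1 h1 h2)
  · rw [Finset.card_product]
    gcongr
    exact (card_powerset_filter_card_le _ _).trans (by gcongr)

/-- A bound on the number of completion times. -/
noncomputable def gridBound : Polynomial ℕ := (2 * (.X * (.X + 2)) + 1) * (4 * .X + 1)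

/-- A bound on the length of the representation of a layer. -/
noncomputable def layerBound (k : ℕ) : Polynomial ℕ :=
  gridBound * (.X * (2 * gridBound) + 1) ^ k * (.X * (5 * .X + 10) + 2) + 1

theorem size_le_of_mem_jobs {p : ℕ × ℕ} (hp : p ∈ d.jobs) :
    Nat.size p.1 ≤ len d ∧ Nat.size p.2 ≤ len d := by
  have h1 := len_le_of_mem hp
  have h2 : len d.jobs ≤ len d := by
    simp only [Input.jobs, len_prod]
    omega
  simp only [len_prod, len_nat] at h1
  simp only [len_prod] at h2 ⊢
  omega

theorem duration_lt (d : Input) (j l : ℕ) : duration d j l < 2 ^ len d := by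
  rw [← Nat.size_le]
  unfold duration
  have h : Nat.size (d.jobs.getD j (0, 0)).1 ≤ len d ∧
      Nat.size (d.jobs.getD j (0, 0)).2 ≤ len d := by
    by_cases hj : j < d.jobs.length
    · rw [List.getD_eq_getElem _ _ hj]
      exact size_le_of_mem_jobs (List.getElem_mem hj)
    · rw [List.getD_eq_default _ _ (by omega)]
      simp
  split_ifs
  exacts [h.1, h.2]

theorem delay_lt {e : ℕ × ℕ × ℕ} (he : e ∈ d.edges) : e.2.2 < 2 ^ len d := by
  rw [← Nat.size_le]
  have h1 := len_le_of_mem he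
  have h2 : len d.edges ≤ len d := by
    simp only [Input.edges, len_prod]
    omega
  simp only [len_prod, len_nat] at h1
  simp only [len_prod] at h2 ⊢
  omega

theorem len_layer_le (hd : d.WellFormed) {k N : ℕ}
    (hcut : ∀ s, Reach d s → (cutEdges d s).card ≤ k) (hN : len d ≤ N)
    (hε : d.epsDen / d.epsNum ≤ N) (m : ℕ) : len (layer d m) ≤ (layerBound k).eval N := by
  have hjobs : d.jobs.length ≤ N := by
    have := length_le_len d.jobs
    refine le_trans ?_ hN
    simp only [Input.jobs, len_prod] at *
    omega
  have hedges : d.edges.length ≤ N := by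
    have := length_le_len d.edges
    refine le_trans ?_ hN
    simp only [Input.edges, len_prod] at *
    omega
  have hacc : d.accuracy ≤ N * (N + 2) := by
    unfold Input.accuracy
    gcongr
  have hp : 2 ^ len d ≤ 2 ^ N := Nat.pow_le_pow_right (by norm_num) hN
  have hdur : ∀ j l, duration d j l < 2 ^ N := fun j l => (duration_lt d j l).trans_le hp
  have hdel : ∀ e ∈ d.edges, e.2.2 < 2 ^ N := fun e he => (delay_lt he).trans_le hp
  -- The exponents run up to `N + 3n`, so there are at most `4N + 1` of them.
  have hg : (grid d (N + 3 * d.jobs.length)).card ≤ (2 * (N * (N + 2)) + 1) * (4 * N + 1) :=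
    (card_grid_le _ _).trans (Nat.mul_le_mul (by omega) (by omega))
  have hcount := length_layer_le hd hdur hdel hcut m hg
  have hlen : ∀ s ∈ layer d m, len s ≤ N * (5 * N + 10) + 1 := by
    intro s hs
    have h1 := (reach_of_mem_layer hs).1
    have h2 := (h1.length_le hd).trans hjobs
    refine (len_list_le (m := 5 * N + 9) fun e he => ?_).trans (by gcongr)
    obtain ⟨h3, h4, h5, -⟩ := h1.entry hd.accuracy_pos hd.source_lt hdur hdel e he
    have h6 : Nat.size e.1 ≤ N := Nat.size_le.2 (lt_of_lt_of_le (by omega)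
      (Nat.lt_two_pow_self (n := N)).le)
    have h7 : Nat.size e.2.1 ≤ 1 := Nat.size_le.2 (by simpa using h4)
    have h8 := Nat.size_le.2 h5
    simp only [len_prod, len_nat]
    omega
  refine (len_list_le hlen).trans ?_
  simp only [layerBound, gridBound, Polynomial.eval_add, Polynomial.eval_mul, Polynomial.eval_pow,
    Polynomial.eval_X, Polynomial.eval_ofNat, Polynomial.eval_one]
  refine Nat.add_le_add_right (Nat.mul_le_mul_right _ (hcount.trans ?_)) 1
  gcongr

end Count

/-! ## The program -/

/-- The test, the body and the final selection are `PolyTime` functions with polynomials independent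
of `k`. Only the bound `B` on the length of the loop state involves `k`, through `layerBound`. -/
theorem exists_program : ∃ P : Prog, ∀ k : ℕ, ∃ q : Polynomial ℕ, ∀ (d : Input) (N : ℕ),
    d.WellFormed → (∀ s, Reach d s → (cutEdges d s).card ≤ k) → len d ≤ N →
      d.epsDen / d.epsNum ≤ N →
        ∃ t, Runs P (enc d) (enc (output d (solution d))) t ∧ t ≤ q.eval N := by
  obtain ⟨p₁, q₁, h₁⟩ : PolyTime fun d : Input => (d, d.jobs.tail, firstLayer d) := by fun_prop
  obtain ⟨p₂, q₂, h₂⟩ : PolyTime fun x : Input × List (ℕ × ℕ) × List Partial =>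
    decide (x.2.1.length ≠ 0) := by fun_prop
  obtain ⟨p₃, q₃, h₃⟩ : PolyTime fun x : Input × List (ℕ × ℕ) × List Partial =>
    (x.1, x.2.1.tail, nextLayer x.1 x.2.2) := by fun_prop
  obtain ⟨p₄, q₄, h₄⟩ : PolyTime fun x : Input × List (ℕ × ℕ) × List Partial =>
    output x.1 (best x.2.2) := by fun_prop
  refine ⟨.comp p₄ (.comp (.loop p₂ p₃) p₁), fun k => ?_⟩
  let B : Polynomial ℕ := 2 * .X + layerBound k + 2
  let T : Polynomial ℕ := q₂.comp B + q₃.comp B + B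
  refine ⟨q₁ + .X * (3 * T) + q₄.comp B + B + .X + .X, fun d N hd hcut hN hε => ?_⟩
  set m := d.jobs.length - 1 with hm
  -- The list of jobs without its first entry serves as a unary counter for the `n - 1` rounds; the
  -- first layer already contains the source.
  let x : ℕ → Input × List (ℕ × ℕ) × List Partial := fun i => (d, d.jobs.tail.drop i, layer d i)
  have hjobs : len d.jobs ≤ len d := by
    simp only [Input.jobs, len_prod]
    omega
  have hdrop : ∀ (i : ℕ) (l : List (ℕ × ℕ)), len (l.drop i) ≤ len l := by
    intro i
    induction i with
    | zero => simp
    | succ i ih =>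
      intro l
      cases l with
      | nil => simp
      | cons a l =>
        have := ih l
        simp only [List.drop_succ_cons, len_cons]
        omega
  have hB : ∀ i, len (x i) ≤ B.eval N := by
    intro i
    have h1 := len_layer_le hd hcut hN hε i
    have h2 := hdrop i d.jobs.tail
    have h3 := hdrop 1 d.jobs
    rw [List.drop_one] at h3
    have h4 : len (x i) = len d + (len (d.jobs.tail.drop i) + len (layer d i) + 1) + 1 := rfl
    rw [h4]
    simp only [B, Polynomial.eval_add, Polynomial.eval_mul, Polynomial.eval_X,
      Polynomial.eval_ofNat]
    omega
  have hx : ∀ i, x (i + 1) = ((x i).1, (x i).2.1.tail, nextLayer (x i).1 (x i).2.2) := by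
    intro i
    simp only [x, layer_succ, List.tail_drop]
  have hT : T.eval N = q₂.eval (B.eval N) + q₃.eval (B.eval N) + B.eval N := by
    simp only [T, Polynomial.eval_add, Polynomial.eval_comp]
  have hlen : ∀ i, decide ((x i).2.1.length ≠ 0) = decide (i < m) := by
    intro i
    simp only [x, List.length_drop, List.length_tail, decide_eq_decide]
    omega
  obtain ⟨t₁, ht₁, hq₁, -⟩ := h₁ d
  obtain ⟨t₂, ht₂, hq₂⟩ := Runs.loop_of_seq (c := p₂) (f := p₃) (m := m) (T := T.eval N)
    (x := fun i => enc (x i)) (fun i hi => by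
      obtain ⟨t, ht, hq, -⟩ := h₂ (x i)
      change Runs _ _ (enc (decide ((x i).2.1.length ≠ 0))) _ at ht
      rw [hlen, decide_eq_true hi] at ht
      have := eval_mono q₂ (hB i)
      exact ⟨_, t, ht, by simp [enc], by omega⟩) (fun i hi => by
      obtain ⟨t, ht, hq, -⟩ := h₃ (x i)
      replace ht : Runs p₃ (enc (x i)) (enc (x (i + 1))) t := by rw [hx]; exact ht
      have := eval_mono q₃ (hB i)
      exact ⟨t, ht, by omega⟩) (by
      obtain ⟨t, ht, hq, -⟩ := h₂ (x m)
      change Runs _ _ (enc (decide ((x m).2.1.length ≠ 0))) _ at ht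
      rw [hlen, decide_eq_false (lt_irrefl m)] at ht
      have := eval_mono q₂ (hB m)
      exact ⟨t, ht, by omega⟩) (fun i hi => by
      have := hB i
      rw [len] at this
      omega)
  obtain ⟨t₃, ht₃, hq₃, -⟩ := h₄ (x m)
  refine ⟨_, .comp (.comp ht₁ ht₂) ht₃, ?_⟩
  have e1 := eval_mono q₁ hN
  have e4 := eval_mono q₄ (hB m)
  have e5 := hB m
  have e6 : (m + 1) * (3 * T.eval N) ≤ N * (3 * T.eval N) := by
    gcongr
    have := length_le_len d.jobs
    have := hd.source_lt
    omega
  simp only [Polynomial.eval_add, Polynomial.eval_mul, Polynomial.eval_X, Polynomial.eval_ofNat,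
    Polynomial.eval_comp]
  simp only [len] at *
  omega

/-! ## Instances and inputs -/

/-- The input whose representation is `encodeInput I b ε`. -/
def inputOf (I : Instance) (b : ℕ) (ε : ℚ) : Input :=
  ((I.n, I.source, I.sink, (List.finRange I.n).map fun j => (I.pS j, (I.pC j).toNat),
    (((List.finRange I.n).product (List.finRange I.n)).filter (· ∈ I.E)).map fun e =>
      ((e.1 : ℕ), (e.2 : ℕ), I.delay e.1 e.2), 0), b, ε.num.toNat, ε.den, 0)

/-- The two zeros in `inputOf` are the terminators of the encoded lists, so the tuple and the lists
are the same data. -/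
theorem enc_inputOf (I : Instance) (b : ℕ) (ε : ℚ) : enc (inputOf I b ε) = encodeInput I b ε := by
  simp only [enc, inputOf, encodeInput, Instance.encode, Instance.encodeJobs,
    Instance.encodeEdges, List.map_map, Data.ofList]
  rfl

/-! ### Translation between instances and inputs -/

section Instances

variable {I : Instance} {b : ℕ} {ε : ℚ}

theorem length_jobs_inputOf : (inputOf I b ε).jobs.length = I.n := by
  simp [inputOf, Input.jobs]

theorem mem_edges_inputOf {e : ℕ × ℕ × ℕ} : e ∈ (inputOf I b ε).edges ↔
    ∃ i j, (i, j) ∈ I.E ∧ e = ((i : ℕ), (j : ℕ), I.delay i j) := by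
  simp only [inputOf, Input.edges, List.mem_map, List.mem_filter, decide_eq_true_eq, Prod.exists]
  constructor
  · rintro ⟨i, j, ⟨-, h⟩, rfl⟩
    exact ⟨i, j, h, rfl⟩
  · rintro ⟨i, j, h, rfl⟩
    exact ⟨i, j, ⟨List.pair_mem_product.2 ⟨List.mem_finRange _, List.mem_finRange _⟩, h⟩, rfl⟩

theorem duration_inputOf_zero (j : Fin I.n) : duration (inputOf I b ε) j 0 = I.pS j := by
  simp [duration, inputOf, Input.jobs]

theorem duration_inputOf_one (j : Fin I.n) :
    duration (inputOf I b ε) j 1 = (I.pC j).toNat := by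
  simp [duration, inputOf, Input.jobs]

theorem wellFormed_inputOf : (inputOf I b ε).WellFormed where
  source_lt := by rw [length_jobs_inputOf]; exact I.source.2
  sink_lt := by rw [length_jobs_inputOf]; exact I.sink.2
  edges_lt := by
    rw [length_jobs_inputOf]
    intro e he
    obtain ⟨i, j, -, rfl⟩ := mem_edges_inputOf.1 he
    exact ⟨i.2, j.2⟩
  acyclic := by
    classical
    -- The rank of a job is the number of its proper ancestors. Along an edge the tail becomes a new
    -- ancestor, and by acyclicity it is not one of its own.
    refine ⟨fun j => (Finset.univ.filter fun i : Fin I.n => ∃ j' : Fin I.n, (j' : ℕ) = j ∧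
      Relation.TransGen (fun a b => (a, b) ∈ I.E) i j').card, fun e he => ?_⟩
    obtain ⟨i, j, hij, rfl⟩ := mem_edges_inputOf.1 he
    refine Finset.card_lt_card ⟨fun x hx => ?_, fun h => ?_⟩
    · simp only [Finset.mem_filter, Finset.mem_univ, true_and] at hx ⊢
      obtain ⟨i', hi', hx⟩ := hx
      obtain rfl := Fin.ext hi'
      exact ⟨j, rfl, hx.tail hij⟩
    · have h1 := @h i (by simpa using ⟨j, rfl, .single hij⟩)
      simp only [Finset.mem_filter, Finset.mem_univ, true_and] at h1
      obtain ⟨i', hi', h1⟩ := h1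
      obtain rfl := Fin.ext hi'
      exact I.acyclic _ h1
  source_min := by
    intro e he h
    obtain ⟨i, j, hij, rfl⟩ := mem_edges_inputOf.1 he
    exact (I.isSource_iff j).2 (Fin.ext h) i hij
  exists_pred := by
    rw [length_jobs_inputOf]
    intro j hj hj'
    have h1 : ¬ ∀ i, (i, (⟨j, hj⟩ : Fin I.n)) ∉ I.E := fun h =>
      hj' (congrArg Fin.val ((I.isSource_iff _).1 h))
    push Not at h1
    obtain ⟨i, hi⟩ := h1
    exact ⟨_, mem_edges_inputOf.2 ⟨_, _, hi, rfl⟩, rfl⟩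
  exists_succ := by
    rw [length_jobs_inputOf]
    intro j hj hj'
    have h1 : ¬ ∀ i, ((⟨j, hj⟩ : Fin I.n), i) ∉ I.E := fun h =>
      hj' (congrArg Fin.val ((I.isSink_iff _).1 h))
    push Not at h1
    obtain ⟨i, hi⟩ := h1
    exact ⟨_, mem_edges_inputOf.2 ⟨_, _, hi, rfl⟩, rfl⟩
  duration_source := (duration_inputOf_zero I.source).trans I.pS_source
  accuracy_pos := by
    have := I.source.pos
    rw [Input.accuracy, length_jobs_inputOf]
    positivity

/-- The done jobs contain the source and are closed under predecessors, so they are one of the sets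
over which `Instance.maxCut` is taken. -/
theorem card_cutEdges_le {s : Partial} (hs : Reach (inputOf I b ε) s) :
    (cutEdges (inputOf I b ε) s).card ≤ I.maxCut := by
  let A : Finset (Fin I.n) := Finset.univ.filter fun j => Done s j
  have hA : A ∈ I.initialSets := by
    simp only [Instance.initialSets, Finset.mem_filter, Finset.mem_univ, true_and, A]
    refine ⟨hs.done_source, fun e he h => h.1 ?_⟩
    exact (hs.precedence wellFormed_inputOf
      (e := ((e.1 : ℕ), (e.2 : ℕ), I.delay e.1 e.2)) (mem_edges_inputOf.2 ⟨_, _, he, rfl⟩) h.2).1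
  refine le_trans ?_ (Finset.le_sup (f := fun A => (I.cut A).card) hA)
  refine le_trans (Finset.card_le_card (t := (I.cut A).image fun e =>
    ((e.1 : ℕ), (e.2 : ℕ), I.delay e.1 e.2)) fun e he => ?_) Finset.card_image_le
  obtain ⟨h1, h2, h3⟩ := mem_cutEdges.1 he
  obtain ⟨i, j, hij, rfl⟩ := mem_edges_inputOf.1 h1
  exact Finset.mem_image.2 ⟨(i, j), by simp [Instance.cut, hij, A, h2, h3], rfl⟩

/-- The schedule with given locations and completion times. -/
def scheduleOf (I : Instance) (loc C : ℕ → ℕ) : Schedule I where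
  server := Finset.univ.filter fun j => loc j = 0
  C j := C j

theorem mem_cloud_scheduleOf {loc C : ℕ → ℕ} {j : Fin I.n} :
    j ∈ (scheduleOf I loc C).cloud ↔ loc j ≠ 0 := by
  simp [Schedule.cloud, scheduleOf]

theorem time_eq_of_pC_ne_top (π : Schedule I) {j : Fin I.n} (h : j ∉ π.server → I.pC j ≠ ⊤) :
    π.time j = (duration (inputOf I b ε) j (if j ∈ π.server then 0 else 1) : ℕ) := by
  unfold Schedule.time
  split_ifs with hj
  · rw [duration_inputOf_zero]
  · rw [duration_inputOf_one, ENat.natCast_toNat (h hj)]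

theorem crosses_iff (π : Schedule I) (i j : Fin I.n) :
    π.Crosses i j ↔ ¬ ((i ∈ π.server) ↔ (j ∈ π.server)) := by
  simp only [Schedule.Crosses, Schedule.cloud, Finset.mem_compl]
  tauto

/-! ### Feasible data versus valid schedules within the budget -/

namespace Feasible

variable {loc C : ℕ → ℕ}

theorem time_scheduleOf (h : Feasible (inputOf I b ε) loc C) (j : Fin I.n) :
    (scheduleOf I loc C).time j = (duration (inputOf I b ε) j (loc j) : ℕ) := by
  have h1 := h.loc_lt j
  rw [time_eq_of_pC_ne_top (b := b) (ε := ε)]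
  · simp only [scheduleOf, Finset.mem_filter, Finset.mem_univ, true_and]
    congr 2
    split_ifs <;> omega
  · simp only [scheduleOf, Finset.mem_filter, Finset.mem_univ, true_and, ne_eq, I.pC_eq_top_iff]
    rintro h2 (rfl | rfl)
    · exact h.loc_eq_one I.source (by omega) (.inl rfl)
    · exact h.loc_eq_one I.sink (by omega) (.inr rfl)

theorem valid_scheduleOf (h : Feasible (inputOf I b ε) loc C) : (scheduleOf I loc C).Valid := by
  have hn := length_jobs_inputOf (I := I) (b := b) (ε := ε)
  have hedge : ∀ i j : Fin I.n, (i, j) ∈ I.E → C i + (if loc i = loc j then 0 else I.delay i j) +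
      duration (inputOf I b ε) j (loc j) ≤ C j := fun i j hij =>
    h.precedence _ (mem_edges_inputOf.2 ⟨i, j, hij, rfl⟩)
  have hserver : ∀ j : Fin I.n, j ∈ (scheduleOf I loc C).server ↔ loc j = 0 := fun j => by
    simp [scheduleOf]
  constructor
  · intro i hi j hj hij
    rw [hserver] at hi hj
    have h1 := h.sequential i (hn.symm ▸ i.2) j (hn.symm ▸ j.2) hi hj fun h => hij (Fin.ext h)
    rw [h.time_scheduleOf, h.time_scheduleOf, hi, hj]
    exact_mod_cast h1
  · intro i j hij hc
    rw [crosses_iff, not_not, hserver, hserver] at hc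
    have h1 := hedge i j hij
    have h2 := h.loc_lt i
    have h3 := h.loc_lt j
    rw [if_pos (by omega)] at h1
    rw [h.time_scheduleOf]
    exact_mod_cast h1
  · intro i j hij hc
    rw [crosses_iff, hserver, hserver] at hc
    have h1 := hedge i j hij
    have h2 := h.loc_lt i
    have h3 := h.loc_lt j
    rw [if_neg (by omega)] at h1
    rw [h.time_scheduleOf]
    exact_mod_cast h1

theorem cost_scheduleOf_le (h : Feasible (inputOf I b ε) loc C) :
    (scheduleOf I loc C).cost ≤ b := by
  have h1 := h.cost_le
  rw [length_jobs_inputOf, Finset.sum_range, ← Finset.sum_filter] at h1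
  have h2 : (scheduleOf I loc C).cloud = Finset.univ.filter fun j : Fin I.n => loc j = 1 := by
    ext j
    have := h.loc_lt j
    rw [mem_cloud_scheduleOf]
    simp only [Finset.mem_filter, Finset.mem_univ, true_and]
    omega
  rw [Schedule.cost, h2, Finset.sum_congr rfl fun j hj => (h.time_scheduleOf j).trans
    (by rw [(Finset.mem_filter.1 hj).2])]
  exact_mod_cast h1

theorem of_valid {π : Schedule I} (h : π.Valid) (hb : π.cost ≤ b) :
    ∃ loc C : ℕ → ℕ, Feasible (inputOf I b ε) loc C ∧ C I.sink = π.makespan := by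
  have hn := length_jobs_inputOf (I := I) (b := b) (ε := ε)
  -- A finite budget keeps jobs with infinite cloud time out of the cloud, so passing to natural
  -- numbers by `ENat.toNat` loses nothing.
  have hcloud : ∀ j, j ∉ π.server → I.pC j ≠ ⊤ := by
    intro j hj htop
    have h1 : π.time j ≤ π.cost := Finset.single_le_sum (f := π.time) (fun _ _ => zero_le)
      (Finset.mem_compl.2 hj)
    rw [Schedule.time, if_neg hj, htop, top_le_iff] at h1
    rw [h1] at hb
    exact ENat.natCast_ne_top b (top_le_iff.1 hb)
  let loc : ℕ → ℕ := fun j => if h : j < I.n then (if ⟨j, h⟩ ∈ π.server then 0 else 1) else 0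
  let C : ℕ → ℕ := fun j => if h : j < I.n then π.C ⟨j, h⟩ else 0
  have hloc : ∀ j : Fin I.n, loc j = if j ∈ π.server then 0 else 1 := fun j => by simp [loc]
  have hC : ∀ j : Fin I.n, C j = π.C j := fun j => by simp [C]
  have htime : ∀ j : Fin I.n, π.time j = (duration (inputOf I b ε) j (loc j) : ℕ) := fun j => by
    rw [hloc, time_eq_of_pC_ne_top π (hcloud j)]
  refine ⟨loc, C, ⟨?_, ?_, ?_, ?_, ?_⟩, hC _⟩
  · intro j
    simp only [loc]
    split_ifs <;> omega
  · rw [hn]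
    intro i hi j hj hi0 hj0 hij
    lift i to Fin I.n using hi
    lift j to Fin I.n using hj
    have h1 : i ∈ π.server := by
      rw [hloc] at hi0
      by_contra h
      simp [h] at hi0
    have h2 : j ∈ π.server := by
      rw [hloc] at hj0
      by_contra h
      simp [h] at hj0
    have h3 := h.server_sequential i h1 j h2 fun h => hij (congrArg Fin.val h)
    rw [htime, htime, hi0, hj0] at h3
    rw [hC, hC]
    exact_mod_cast h3
  · intro e he
    obtain ⟨i, j, hij, rfl⟩ := mem_edges_inputOf.1 he
    dsimp only
    rw [hC, hC]
    by_cases hc : π.Crosses i j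
    · have h1 := h.communication i j hij hc
      rw [htime] at h1
      have h2 : loc i ≠ loc j := by
        rw [crosses_iff] at hc
        rw [hloc, hloc]
        split_ifs <;> simp_all
      rw [if_neg h2]
      exact_mod_cast h1
    · have h1 := h.precedence i j hij hc
      rw [htime] at h1
      have h2 : loc i = loc j := by
        rw [crosses_iff, not_not] at hc
        rw [hloc, hloc]
        simp only [hc]
      rw [if_pos h2]
      exact_mod_cast h1
  · intro j hj hj'
    have hj0 : j < I.n := by
      by_contra h
      simp [loc, h] at hj
    lift j to Fin I.n using hj0
    rw [hloc] at hj
    have h1 : j ∉ π.server := by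
      intro h
      simp [h] at hj
    exact hcloud j h1 ((I.pC_eq_top_iff j).2 (hj'.imp (fun h => Fin.ext h) fun h => Fin.ext h))
  · rw [hn, Finset.sum_range, ← Finset.sum_filter]
    have h2 : π.cloud = Finset.univ.filter fun j : Fin I.n => loc j = 1 := by
      ext j
      simp [Schedule.cloud, hloc]
    rw [Schedule.cost, h2, Finset.sum_congr rfl fun j hj => (htime j).trans
      (by rw [(Finset.mem_filter.1 hj).2])] at hb
    exact_mod_cast hb

end Feasible

/-- With `M = n(q + 2)` and `q = ⌊1/ε⌋`, the inverse of `1 + 1/M` is `1 - 1/(M + 1)`. Bernoulli's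
inequality bounds the `n`-th power of the latter below by `1 - n/(M + 1)`, and `ε(q + 1) ≥ 1` shows
that this is at least `1/(1 + ε)`. -/
theorem one_add_pow_le {ε : ℚ} (hε : 0 < ε) (n : ℕ) :
    (1 + 1 / ((n * (ε.den / ε.num.toNat + 2) : ℕ) : ℚ)) ^ n ≤ 1 + ε := by
  rcases Nat.eq_zero_or_pos n with rfl | hn
  · simp [hε.le]
  have hnum : 0 < ε.num := Rat.num_pos.2 hε
  obtain ⟨a, ha⟩ := Int.eq_ofNat_of_zero_le hnum.le
  have ha0 : 0 < a := by omega
  have hq : 1 ≤ ε * ((ε.den / ε.num.toNat : ℕ) + 1) := by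
    rw [ha, Int.toNat_natCast]
    have h1 : ε = a / ε.den := by
      have := (Rat.num_div_den ε).symm
      rw [ha] at this
      rwa [Int.cast_natCast] at this
    have h2 : ε.den < (ε.den / a + 1) * a := by
      rw [mul_comm]
      exact Nat.lt_mul_div_succ _ ha0
    have h3 : (ε.den : ℚ) ≤ ((ε.den / a : ℕ) + 1) * a := by exact_mod_cast h2.le
    have h4 : (0 : ℚ) < ε.den := by exact_mod_cast ε.den_pos
    calc (1 : ℚ) ≤ ((ε.den / a : ℕ) + 1) * a / ε.den := by rwa [le_div_iff₀ h4, one_mul]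
      _ = a / ε.den * ((ε.den / a : ℕ) + 1) := by ring
      _ = _ := by rw [← h1]
  generalize ε.den / ε.num.toNat = q at *
  have hn' : (0 : ℚ) < n := by exact_mod_cast hn
  have hM : ((n * (q + 2) : ℕ) : ℚ) = n * (q + 2) := by push_cast; ring
  rw [hM]
  set M : ℚ := n * (q + 2) with hMdef
  have hM0 : 0 < M := by positivity
  have hMn : 2 * n ≤ M := by
    rw [hMdef]
    nlinarith [(Nat.cast_nonneg q : (0 : ℚ) ≤ q)]
  have hy : 0 < 1 - n / (M + 1) := by
    rw [sub_pos, div_lt_one (by positivity)]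
    linarith
  have h1 : 1 + (n : ℚ) * (-1 / (M + 1)) ≤ (1 + -1 / (M + 1)) ^ n :=
    one_add_mul_le_pow (by
      rw [le_div_iff₀ (by positivity)]
      linarith) n
  have h2 : (1 + 1 / M) * (1 + -1 / (M + 1)) = 1 := by
    field_simp
    ring
  have h3 : (1 + 1 / M) ^ n * (1 - n / (M + 1)) ≤ 1 := by
    calc (1 + 1 / M) ^ n * (1 - n / (M + 1)) = (1 + 1 / M) ^ n * (1 + n * (-1 / (M + 1))) := by ring
      _ ≤ (1 + 1 / M) ^ n * (1 + -1 / (M + 1)) ^ n := by gcongr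
      _ = 1 := by rw [← mul_pow, h2, one_pow]
  have h4 : 1 ≤ (1 + ε) * (1 - n / (M + 1)) := by
    have : (1 + ε) * (1 - n / (M + 1)) - 1 = (ε * (M + 1 - n) - n) / (M + 1) := by
      field_simp
      ring
    have h5 : 0 ≤ (ε * (M + 1 - n) - n) / (M + 1) := by
      refine div_nonneg ?_ (by positivity)
      have h6 : ε * (M + 1 - n) - n = n * (ε * (q + 1) - 1) + ε := by rw [hMdef]; ring
      rw [h6]
      have : 0 ≤ ε * (q + 1) - 1 := by linarith
      positivity
    linarith
  exact le_of_mul_le_mul_right (h3.trans h4) hy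

/-- In a complete schedule no job has the location `2`, so replacing every location other than `1`
by `0` does not alter the output. -/
theorem encode_scheduleOf_solution :
    (scheduleOf I (fun j => if (lookup (solution (inputOf I b ε)) j).1 = 1 then 1 else 0)
      fun j => (lookup (solution (inputOf I b ε)) j).2).encode =
        enc (output (inputOf I b ε) (solution (inputOf I b ε))) := by
  obtain ⟨h1, h2, -⟩ := solution_spec (wellFormed_inputOf (I := I) (b := b) (ε := ε))
  have hn := length_jobs_inputOf (I := I) (b := b) (ε := ε)
  simp only [Schedule.encode, enc, output, List.map_map]
  rw [hn, ← List.map_coe_finRange_eq_range, List.map_map]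
  congr 1
  refine List.map_congr_left fun j _ => ?_
  have h3 := (h1.done_iff j).1 (h1.done_of_length wellFormed_inputOf h2 (hn.symm ▸ j.2))
  simp only [scheduleOf, Finset.mem_filter, Finset.mem_univ, true_and, Function.comp_apply]
  have h4 : (if (if (lookup (solution (inputOf I b ε)) j).1 = 1 then 1 else 0) = 0 then 0 else 1) =
      (lookup (solution (inputOf I b ε)) j).1 := by
    by_cases h : (lookup (solution (inputOf I b ε)) j).1 = 1
    · simp [h]
    · simp only [h, if_false, if_true]
      omega
  rw [h4]

end Instances

end ServerCloud

/-! ### The approximation scheme -/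

theorem mainTheorem1 :
    ∃ P : ServerCloud.Prog, ∀ k : ℕ, ∃ q : Polynomial ℕ,
      ∀ (I : ServerCloud.Instance) (b : ℕ) (ε : ℚ), I.maxCut ≤ k → 0 < ε →
        ∃ (π : ServerCloud.Schedule I) (t : ℕ),
          ServerCloud.Runs P (ServerCloud.encodeInput I b ε) π.encode t ∧
          t ≤ q.eval ((ServerCloud.encodeInput I b ε).size + ⌈1 / ε⌉₊) ∧
          π.IsApprox b ε := by
  open ServerCloud in
  obtain ⟨P, hP⟩ := exists_program
  refine ⟨P, fun k => ?_⟩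
  obtain ⟨q, hq⟩ := hP k
  refine ⟨q, fun I b ε hk hε => ?_⟩
  have hd := wellFormed_inputOf (I := I) (b := b) (ε := ε)
  -- The quotient `⌊1/ε⌋` enters the number of grid values by its magnitude and not by its length;
  -- this is where the dependence on `1/ε` comes from.
  have hdiv : (inputOf I b ε).epsDen / (inputOf I b ε).epsNum ≤ ⌈1 / ε⌉₊ := by
    have h1 : (1 / ε : ℚ) = (ε.den : ℚ) / (ε.num.toNat : ℕ) := by
      have h := Int.toNat_of_nonneg (Rat.num_pos.2 hε).le
      have h' : (ε.num : ℚ) = (ε.num.toNat : ℕ) := by exact_mod_cast h.symm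
      rw [← h', ← inv_div (ε.num : ℚ), Rat.num_div_den, one_div]
    have h2 : ((ε.den / ε.num.toNat : ℕ) : ℚ) ≤ ⌈1 / ε⌉₊ :=
      (h1 ▸ Nat.cast_div_le).trans (Nat.le_ceil _)
    exact_mod_cast h2
  obtain ⟨t, ht, htq⟩ := hq (inputOf I b ε) ((encodeInput I b ε).size + ⌈1 / ε⌉₊) hd
    (fun s hs => (card_cutEdges_le hs).trans hk)
    (by rw [len, enc_inputOf]; exact Nat.le_add_right _ _) (hdiv.trans (Nat.le_add_left _ _))
  obtain ⟨h1, h2, -⟩ := solution_spec hd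
  have hf := h1.feasible hd h2
  refine ⟨_, t, ?_, htq, hf.valid_scheduleOf, hf.cost_scheduleOf_le, fun π' hv hb => ?_⟩
  · rw [encode_scheduleOf_solution, ← enc_inputOf]
    exact ht
  · obtain ⟨loc, C, hf', hC⟩ := Feasible.of_valid (ε := ε) hv hb
    have h3 := solution_le hd hf'
    rw [← hC]
    refine h3.trans (mul_le_mul_of_nonneg_right ?_ (Nat.cast_nonneg _))
    have h4 := one_add_pow_le hε I.n
    refine le_trans ?_ h4
    have h5 : (inputOf I b ε).accuracy = I.n * (ε.den / ε.num.toNat + 2) := by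
      rw [Input.accuracy, length_jobs_inputOf]
      rfl
    rw [h5, length_jobs_inputOf]
    -- The source is placed at time `0` without rounding, so only `n - 1` factors occur.
    exact pow_le_pow_right₀ (le_add_of_nonneg_right (by positivity)) (Nat.sub_le _ _)
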